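/- \textbf{Setting.} PROMPT-LTL formulas over a countable set of atomic propositions are given in negation normal form by $$\varphi ::= a \mid \neg a \mid \varphi\wedge\varphi \mid \varphi\vee\varphi \mid \mathbf{X}\varphi \mid \varphi\,\mathbf{U}\,\varphi \mid \varphi\,\mathbf{R}\,\varphi \mid \mathbf{F_P}\varphi .$$ For an $\omega$-word $w$ over sets of propositions, a position $n$ and a bound $k\in\mathbb{N}$, satisfaction $(w,n,k)\models\varphi$ is defined as for LTL, with $(w,n,k)\models \mathbf{F_P}\varphi$ iff $(w,n+j,k)\models\varphi$ for some $0\le j\le k$; $(w,k)\models\varphi$ means $(w,0,k)\models\varphi$. An asynchronous architecture $\mathcal{A}$ consists of an environment process and a finite set $P^-$ of system processes, finite sets $O_{env}$ and $I_p, O_p$ ($p\in P^-$) of propositions such that the output sets are pairwise disjoint, and a fresh scheduling proposition $\mathrm{sched}_p$ for each $p\in P^-$. The environment controls $O_{env}\cup\{\mathrm{sched}_p \mid p\in P^-\}$, and process $p$ reads $I_p^*=I_p\cup\{\mathrm{sched}_p\}$. A (finite-state) implementation of $p$ of size $b$ is a function $f_p:(2^{I_p^*})^*\to 2^{O_p}$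 generated by a $2^{O_p}$-labeled deterministic transition system over the input alphabet $2^{I_p^*}$ with $b$ states whose state, after any finite input word, does not change on an input letter without $\mathrm{sched}_p$. The product $\bigotimes_{p} f_p$ is the set of all $\omega$-words $w$ over subsets of the (finite) set of all environment and process outputs such that $w_n\cap O_p=f_p\big((w_0\cap I_p^*)\cdots(w_{n-1}\cap I_p^*)\big)$ for all $p\in P^-$ and $n\in\mathbb{N}$. It satisfies the assume-guarantee specification $\langle\varphi,\psi\rangle$ if for every $k$ there is an $l$ such that for every $w\in\bigotimes_p f_p$, $(w,k)\models\varphi$ implies $(w,l)\models\psi$. The specification $\langle\varphi,\psi\rangle$ is realizable in $\mathcal{A}$ if there are finite-state implementations $f_p$, $p\in P^-$, whose product satisfies it. \textbf{Statement.} (1) For every asynchronous architecture $\mathcal{A}$, the set of pairs $\langle\varphi,\psi\rangle$ of PROMPT-LTL formulas that are realizable in $\mathcal{A}$ is semi-decidable (recursively enumerable). (2) There is an algorithm that, given $\mathcal{A}$, $\langle\varphi,\psi\rangle$ and bounds $(b_p)_{p\in P^-}$, always terminates, decides whether there are implementations $f_p$ of size $b_p$ whose product satisfies $\langle\varphi,\psi\rangle$,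 and, if so, outputs transition systems of these sizes that generate such implementations. (3) There is an algorithm that, given $\mathcal{A}$ and $\langle\varphi,\psi\rangle$, terminates with an output if and only if $\langle\varphi,\psi\rangle$ is realizable in $\mathcal{A}$, and in that case outputs finite transition systems that generate implementations whose product satisfies $\langle\varphi,\psi\rangle$. -/

import Mathlib

namespace PromptLTL

/-- Atomic propositions: `Sum.inl a` is the `a`-th ordinary proposition (an element of `AP`),
`Sum.inr p` is the scheduling proposition `sched_p` of the system process number `p`. -/
abbrev Atom : Type := ℕ ⊕ ℕ

/-- Formulas of PROMPT-LTL, in negation normal form. -/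
inductive Formula : Type
  | atom (a : Atom)
  | natom (a : Atom)
  | next (φ : Formula)
  | prompt (φ : Formula)
  | conj (φ ψ : Formula)
  | disj (φ ψ : Formula)
  | strongUntil (φ ψ : Formula)
  | release (φ ψ : Formula)

namespace Formula

/-- Gödel numbering of formulas; it makes `Formula` an admissible input type of computable
functions. -/
def toNat : Formula → ℕ
  | atom a => 8 * Encodable.encode a
  | natom a => 8 * Encodable.encode a + 1
  | next φ => 8 * toNat φ + 2
  | prompt φ => 8 * toNat φ + 3
  | conj φ ψ => 8 * Nat.pair (toNat φ) (toNat ψ) + 4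
  | disj φ ψ => 8 * Nat.pair (toNat φ) (toNat ψ) + 5
  | strongUntil φ ψ => 8 * Nat.pair (toNat φ) (toNat ψ) + 6
  | release φ ψ => 8 * Nat.pair (toNat φ) (toNat ψ) + 7

/-- Inverse of the Gödel numbering. -/
def ofNat (n : ℕ) : Formula :=
  if n % 8 = 0 then atom (Denumerable.ofNat Atom (n / 8))
  else if n % 8 = 1 then natom (Denumerable.ofNat Atom (n / 8))
  else if n % 8 = 2 then next (ofNat (n / 8))
  else if n % 8 = 3 then prompt (ofNat (n / 8))
  else if n % 8 = 4 then conj (ofNat (n / 8).unpair.1) (ofNat (n / 8).unpair.2)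
  else if n % 8 = 5 then disj (ofNat (n / 8).unpair.1) (ofNat (n / 8).unpair.2)
  else if n % 8 = 6 then strongUntil (ofNat (n / 8).unpair.1) (ofNat (n / 8).unpair.2)
  else release (ofNat (n / 8).unpair.1) (ofNat (n / 8).unpair.2)
termination_by n
decreasing_by
  all_goals
    have h1 := Nat.unpair_left_le (n / 8)
    have h2 := Nat.unpair_right_le (n / 8)
    omega

theorem ofNat_toNat (φ : Formula) : ofNat (toNat φ) = φ := by
  have key : ∀ m r : ℕ, r < 8 → (8 * m + r) % 8 = r ∧ (8 * m + r) / 8 = m := by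
    intro m r h; omega
  induction φ with
  | atom a =>
    have h := key (Encodable.encode a) 0 (by norm_num)
    simp only [add_zero] at h
    rw [toNat, ofNat]
    simp [h.1]
  | natom a =>
    have h := key (Encodable.encode a) 1 (by norm_num)
    rw [toNat, ofNat]; simp only [h.1, h.2]; simp
  | next φ ih =>
    have h := key (toNat φ) 2 (by norm_num)
    rw [toNat, ofNat]; simp only [h.1, h.2]; simp [ih]
  | prompt φ ih =>
    have h := key (toNat φ) 3 (by norm_num)
    rw [toNat, ofNat]; simp only [h.1, h.2]; simp [ih]
  | conj φ ψ ih1 ih2 =>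
    have h := key (Nat.pair (toNat φ) (toNat ψ)) 4 (by norm_num)
    rw [toNat, ofNat]; simp only [h.1, h.2]; simp [ih1, ih2]
  | disj φ ψ ih1 ih2 =>
    have h := key (Nat.pair (toNat φ) (toNat ψ)) 5 (by norm_num)
    rw [toNat, ofNat]; simp only [h.1, h.2]; simp [ih1, ih2]
  | strongUntil φ ψ ih1 ih2 =>
    have h := key (Nat.pair (toNat φ) (toNat ψ)) 6 (by norm_num)
    rw [toNat, ofNat]; simp only [h.1, h.2]; simp [ih1, ih2]
  | release φ ψ ih1 ih2 =>
    have h := key (Nat.pair (toNat φ) (toNat ψ)) 7 (by norm_num)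
    rw [toNat, ofNat]; simp only [h.1, h.2]; simp [ih1, ih2]

theorem toNat_ofNat (n : ℕ) : toNat (ofNat n) = n := by
  induction n using Nat.strong_induction_on with
  | _ n ih =>
    have h1 := Nat.unpair_left_le (n / 8)
    have h2 := Nat.unpair_right_le (n / 8)
    rw [ofNat]
    split_ifs
    · simp only [toNat, Denumerable.encode_ofNat]; omega
    · simp only [toNat, Denumerable.encode_ofNat]; omega
    · simp only [toNat]; rw [ih _ (by omega)]; omega
    · simp only [toNat]; rw [ih _ (by omega)]; omega
    all_goals
      simp only [toNat]
      rw [ih _ (by omega), ih _ (by omega), Nat.pair_unpair]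
      omega

instance : Denumerable Formula :=
  Denumerable.mk' ⟨toNat, ofNat, ofNat_toNat, toNat_ofNat⟩

/-- `φ.Sat w n k`: the word `w` satisfies `φ` at position `n` with respect to the bound `k`. -/
def Sat (w : ℕ → Set Atom) : Formula → ℕ → ℕ → Prop
  | atom a, n, _ => a ∈ w n
  | natom a, n, _ => a ∉ w n
  | next φ, n, k => Sat w φ (n + 1) k
  | prompt φ, n, k => ∃ j ≤ k, Sat w φ (n + j) k
  | conj φ ψ, n, k => Sat w φ n k ∧ Sat w ψ n k
  | disj φ ψ, n, k => Sat w φ n k ∨ Sat w ψ n k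
  | strongUntil φ ψ, n, k => ∃ j, Sat w ψ (n + j) k ∧ ∀ i < j, Sat w φ (n + i) k
  | release φ ψ, n, k => ∀ j, Sat w ψ (n + j) k ∨ ∃ i < j, Sat w φ (n + i) k

end Formula

/-- A strategy `f : (2^I)^* → 2^O`. -/
abbrev Strategy (I O : Finset Atom) : Type := List (Set I) → Set O

/-- A `2^O`-labeled `2^I`-transition system with set of states `S`. -/
structure TransitionSystem (I O : Finset Atom) (S : Type) where
  init : S
  step : S → Set I → S
  label : S → Set O

namespace TransitionSystem

variable {I O : Finset Atom} {S : Type}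

/-- The extension `Δ^*` of the transition function to finite input words. -/
def run (T : TransitionSystem I O S) (u : List (Set I)) : S := u.foldl T.step T.init

/-- The strategy generated by a transition system. -/
def strategy (T : TransitionSystem I O S) : Strategy I O := fun u => T.label (T.run u)

end TransitionSystem

/-- An architecture.  The processes are the environment and the system processes `Fin numSys`;
the environment has no inputs; the outputs of distinct processes are disjoint. -/
structure Architecture where
  numSys : ℕ
  envOut : Finset ℕ
  inp : Fin numSys → Finset ℕ
  out : Fin numSys → Finset ℕ
  disjoint_env : ∀ p, Disjoint envOut (out p)
  disjoint_sys : ∀ p q, p ≠ q → Disjoint (out p) (out q)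

/-- Finite descriptions of architectures: the environment outputs, and the pair of the inputs
and the outputs of every system process. -/
abbrev ArchCode : Type := List ℕ × List (List ℕ × List ℕ)

/-- Finite descriptions of distributed implementations: for every system process the initial
state, the transition table (one row per state, one column per input letter), and the label
of every state. -/
abbrev ImplCode : Type := List (ℕ × List (List ℕ) × List (List ℕ))

namespace Architecture

variable (A : Architecture)

/-- The description of an architecture that algorithms receive as input. -/
def code : ArchCode :=
  (A.envOut.sort (· ≤ ·),
    List.ofFn fun p => ((A.inp p).sort (· ≤ ·), (A.out p).sort (· ≤ ·)))

/-- The inputs `I_p^* = I_p ∪ {sched_p}` in the asynchronous architecture. -/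
def inpStar (p : Fin A.numSys) : Finset Atom :=
  insert (Sum.inr (p : ℕ)) ((A.inp p).image Sum.inl)

/-- The outputs `O_p` of a system process, as propositions. -/
def outStar (p : Fin A.numSys) : Finset Atom := (A.out p).image Sum.inl

/-- The outputs `O_env ∪ Sched` of the environment in the asynchronous architecture. -/
def envOutStar : Finset Atom :=
  A.envOut.image Sum.inl ∪ Finset.univ.image fun p : Fin A.numSys => Sum.inr (p : ℕ)

/-- All propositions of the asynchronous architecture. -/
def props : Finset Atom := A.envOutStar ∪ Finset.univ.biUnion A.outStar

/-- When process `p` is not scheduled, its state does not change. -/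
def Asynchronous (p : Fin A.numSys) {S : Type}
    (T : TransitionSystem (A.inpStar p) (A.outStar p) S) : Prop :=
  ∀ (u : List (Set (A.inpStar p))) (x : Set (A.inpStar p)),
    (∀ a ∈ x, (a : Atom) ≠ Sum.inr (p : ℕ)) → T.run (u ++ [x]) = T.run u

/-- `f` is a finite-state implementation of process `p` in the asynchronous architecture. -/
def IsImplementation (p : Fin A.numSys) (f : Strategy (A.inpStar p) (A.outStar p)) : Prop :=
  ∃ (S : Type) (_ : Finite S) (T : TransitionSystem (A.inpStar p) (A.outStar p) S),
    A.Asynchronous p T ∧ T.strategy = f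

/-- `f` is an implementation of process `p` of size `b`. -/
def IsImplementationOfSize (p : Fin A.numSys) (b : ℕ)
    (f : Strategy (A.inpStar p) (A.outStar p)) : Prop :=
  ∃ T : TransitionSystem (A.inpStar p) (A.outStar p) (Fin b),
    A.Asynchronous p T ∧ T.strategy = f

/-- The words of the distributed product of the strategies `f p`: the environment outputs are
arbitrary, and the outputs of process `p` at position `n` are those which `f p` chooses after
the inputs of `p` at the positions before `n`. -/
def product (f : ∀ p, Strategy (A.inpStar p) (A.outStar p)) : Set (ℕ → Set Atom) :=
  {w | (∀ n, w n ⊆ A.props) ∧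
    ∀ p n, {a : A.outStar p | (a : Atom) ∈ w n} =
      f p (List.ofFn fun i : Fin n => {a : A.inpStar p | (a : Atom) ∈ w i})}

/-- The distributed product of the `f p` satisfies the assume-guarantee specification
`(φ, ψ)`. -/
def Satisfies (f : ∀ p, Strategy (A.inpStar p) (A.outStar p)) (φ ψ : Formula) : Prop :=
  ∀ k, ∃ l, ∀ w ∈ A.product f, φ.Sat w 0 k → ψ.Sat w 0 l

/-- `(φ, ψ)` is realizable in the asynchronous architecture. -/
def Realizable (φ ψ : Formula) : Prop :=
  ∃ f : ∀ p, Strategy (A.inpStar p) (A.outStar p),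
    (∀ p, A.IsImplementation p (f p)) ∧ A.Satisfies f φ ψ

/-- `(φ, ψ)` is realizable by implementations of the sizes `b p`. -/
def RealizableOfSize (b : Fin A.numSys → ℕ) (φ ψ : Formula) : Prop :=
  ∃ f : ∀ p, Strategy (A.inpStar p) (A.outStar p),
    (∀ p, A.IsImplementationOfSize p (b p) (f p)) ∧ A.Satisfies f φ ψ

open Classical in
/-- The description of a family of transition systems.  The input letters of process `p` are
the subsets of the list `sched_p, (elements of I_p in increasing order)`, in the order of
`List.sublists`; labels are lists of outputs in increasing order. -/
noncomputable def implCode {b : Fin A.numSys → ℕ}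
    (T : ∀ p, TransitionSystem (A.inpStar p) (A.outStar p) (Fin (b p))) : ImplCode :=
  List.ofFn fun p =>
    (((T p).init : ℕ),
      List.ofFn fun s : Fin (b p) =>
        (((Sum.inr (p : ℕ) : Atom) :: ((A.inp p).sort (· ≤ ·)).map Sum.inl).sublists).map
          fun x => (((T p).step s {a | (a : Atom) ∈ x} : Fin (b p)) : ℕ),
      List.ofFn fun s : Fin (b p) =>
        ((A.out p).sort (· ≤ ·)).filter fun o => ∃ a ∈ (T p).label s, (a : Atom) = Sum.inl o)

/-- `c` describes transition systems of sizes `b p` that implement the processes and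
together realize `(φ, ψ)`. -/
def IsSolution (b : Fin A.numSys → ℕ) (φ ψ : Formula) (c : ImplCode) : Prop :=
  ∃ T : ∀ p, TransitionSystem (A.inpStar p) (A.outStar p) (Fin (b p)),
    (∀ p, A.Asynchronous p (T p)) ∧ A.Satisfies (fun p => (T p).strategy) φ ψ ∧
      A.implCode T = c

end Architecture

end PromptLTL

namespace PromptLTL

/-! For given sizes there are finitely many families of transition systems, so everything rests on
deciding, for one family, whether every `k` has an `l` such that the guarantee follows from the
assumption. `Architecture.satisfies_iff` replaces this alternation of quantifiers by the absence of
one counterexample: an ultimately periodic word of bounded size that satisfies `φ` for a fixed bound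
`K` and violates `ψ` for a fixed bound `L`, both computed from the number `N` of snapshots. A
snapshot records the process states at a position and the truth values there of all formulas with
codes up to those of `φ` and `ψ`, hence of all subformulas.

A word is changed by reading it along `g : ℕ → ℕ`. If `g` respects the successor of snapshots
(`succ`) and still visits what lies ahead (`fair`), then `w ∘ g` remains in the product and keeps
the truth of untils and the falsity of releases; `wait` controls how late a prompt eventuality of
the assumption is met, and `hold` how long one of the guarantee stays unmet
(`Formula.Sat.of_reindexing`, `Formula.not_sat_of_reindexing`).

Three reindexings suffice. `exists_reindexing_wait` cuts cycles inside blocks of length `k`, which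
lowers any assumption bound to `K` while a large guarantee bound stays at least `L`.
`exists_reindexing_lasso` turns the result into a small lasso. Conversely, `exists_reindexing_hold`
pumps a cycle in every block, so that one violation for `L` gives violations for all `l` with `K`
unchanged.

Lassos and systems of bounded size are enumerated by primitive recursive functions
(`primrec_solve`), which gives (2). A search through all sizes gives (3), and its domain gives (1).
-/

/-- The sequence `q ∘ g` is a path through the same transitions as `q` that visits all future
states of `q`; bounds on the waiting time change from `k` to `k'`, and bounds on the length of
invariants change from `l` to `l'`. -/
structure Reindexing {Q : Type*} (q : ℕ → Q) (g : ℕ → ℕ) (k k' l l' : ℕ) : Prop where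
  zero : q (g 0) = q 0
  succ : ∀ n, q (g (n + 1)) = q (g n + 1)
  fair : ∀ n x, g n ≤ x → ∃ m, n ≤ m ∧ q (g m) = q x
  wait : ∀ n x, g n ≤ x → x ≤ g n + k → ∃ j ≤ k', q (g (n + j)) = q x
  hold : ∀ n, ∀ j ≤ l', ∃ x, g n ≤ x ∧ x ≤ g n + l ∧ q (g (n + j)) = q x

/-! ### Contracting blocks, and bounding waiting times -/

section Blocks

variable {Q : Type*} {q : ℕ → Q} {e : ℕ → ℕ}

/-- `e` maps every position to the end of its block in a partition of `ℕ` into finite intervals. -/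
def IsBlockEnd (e : ℕ → ℕ) : Prop :=
  ∀ i, i < e i ∧ ∀ j, i ≤ j → j < e i → e j = e i

theorem isBlockEnd_div {k : ℕ} (hk : 0 < k) : IsBlockEnd fun i => (i / k + 1) * k := by
  intro i
  have h := Nat.div_add_mod i k
  have h' := Nat.mod_lt i hk
  refine ⟨by nlinarith, fun j hij hj => ?_⟩
  have h1 : i / k ≤ j / k := Nat.div_le_div_right hij
  have h2 : j / k < i / k + 1 := Nat.div_lt_of_lt_mul (by simpa [mul_comm] using hj)
  have : j / k = i / k := by omega
  simp [this]

/-- A position together with the states that are visited in the rest of its block. -/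
def withRest (q : ℕ → Q) (e : ℕ → ℕ) (i : ℕ) : Q × Set Q := (q i, q '' Set.Ico i (e i))

theorem exists_last (he : IsBlockEnd e) (i : ℕ) :
    ∃ j, i ≤ j ∧ j < e i ∧ withRest q e j = withRest q e i ∧
      ∀ x, j < x → x < e i → withRest q e x ≠ withRest q e i := by
  classical
  have hne : ((Finset.Ico i (e i)).filter fun j => withRest q e j = withRest q e i).Nonempty :=
    ⟨i, by simp [(he i).1]⟩
  have hmem := Finset.max'_mem _ hne
  refine ⟨Finset.max' _ hne, ?_, ?_, ?_, ?_⟩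
  · simp only [Finset.mem_filter, Finset.mem_Ico] at hmem; exact hmem.1.1
  · simp only [Finset.mem_filter, Finset.mem_Ico] at hmem; exact hmem.1.2
  · simp only [Finset.mem_filter, Finset.mem_Ico] at hmem; exact hmem.2
  · intro x hx hxe hq
    have : x ≤ Finset.max' _ hne := Finset.le_max' _ _ (by
      simp only [Finset.mem_filter, Finset.mem_Ico] at hmem ⊢
      exact ⟨⟨by omega, hxe⟩, hq⟩)
    omega

/-- The facts about the sequence of positions that always moves on to the last position of the
block with the same state and the same states ahead. -/
structure IsContraction (q : ℕ → Q) (e : ℕ → ℕ) (g : ℕ → ℕ) : Prop where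
  zero : withRest q e (g 0) = withRest q e 0
  zero_lt : g 0 < e 0
  succ : ∀ n, withRest q e (g (n + 1)) = withRest q e (g n + 1)
  lt_succ : ∀ n, g n < g (n + 1)
  succ_lt : ∀ n, g (n + 1) < e (g n + 1)
  last : ∀ n x, g n < x → x < e (g n) → withRest q e x ≠ withRest q e (g n)

theorem exists_isContraction (q : ℕ → Q) (he : IsBlockEnd e) : ∃ g, IsContraction q e g := by
  choose last h1 h2 h3 h4 using exists_last (q := q) he
  let g : ℕ → ℕ := fun n => Nat.rec (last 0) (fun _ i => last (i + 1)) n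
  have hlast : ∀ i x, last i < x → x < e (last i) → withRest q e x ≠ withRest q e (last i) := by
    intro i x hx hxe
    rw [h3]
    rw [(he i).2 _ (h1 i) (h2 i)] at hxe
    exact h4 i x hx hxe
  refine ⟨g, h3 0, h2 0, fun n => h3 _, fun n => h1 (g n + 1), fun n => h2 (g n + 1), ?_⟩
  rintro (_ | n)
  · exact hlast 0
  · exact hlast (g n + 1)

namespace IsContraction

variable {g : ℕ → ℕ}

theorem strictMono (h : IsContraction q e g) : StrictMono g := strictMono_nat_of_lt_succ h.lt_succ

theorem blockEnd_succ (h : IsContraction q e g) (he : IsBlockEnd e) (n : ℕ) :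
    e (g (n + 1)) = e (g n + 1) :=
  (he _).2 _ (h.lt_succ n) (h.succ_lt n)

/-- All states of the original sequence are still visited, in the same block. -/
theorem exists_visit (h : IsContraction q e g) (he : IsBlockEnd e) (n x : ℕ) (hx : g n ≤ x) :
    ∃ m, n ≤ m ∧ q (g m) = q x ∧ g m < e x := by
  induction hd : e x - g n using Nat.strong_induction_on generalizing n x with
  | _ d ih =>
    have hxe := (he x).1
    rcases hx.eq_or_lt with hx | hx
    · exact ⟨n, le_rfl, by rw [hx], by omega⟩
    · have hlt := h.lt_succ n
      by_cases hxs : g (n + 1) ≤ x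
      · obtain ⟨m, hm, hq⟩ := ih (e x - g (n + 1)) (by omega) (n + 1) x hxs rfl
        exact ⟨m, by omega, hq⟩
      · have hsl := h.succ_lt n
        have hex : e x = e (g n + 1) := (he _).2 _ hx (by omega)
        -- The jump skips `x`, but its target has the same states ahead in the block as `g n + 1`,
        -- so the state of `x` occurs again at or after `g (n + 1)`.
        have hmem : q x ∈ (withRest q e (g n + 1)).2 := ⟨x, ⟨hx, by omega⟩, rfl⟩
        rw [← h.succ n] at hmem
        obtain ⟨x', ⟨hx1, hx2⟩, hqx⟩ := hmem
        have hee := h.blockEnd_succ he n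
        have hex' : e x' = e x := by rw [(he _).2 _ hx1 hx2, hee, hex]
        obtain ⟨m, hm, hq, hlt'⟩ :=
          ih (e x' - g (n + 1)) (by omega) (n + 1) x' hx1 rfl
        exact ⟨m, by omega, by rw [hq, hqx], by omega⟩

/-- By `last`, the pairs at visited positions of one block are distinct, and only `card Q * 2 ^ card
Q` pairs exist. -/
theorem blockEnd_le [Fintype Q] (h : IsContraction q e g) (he : IsBlockEnd e) (n : ℕ) :
    e (g n) ≤ g (n + Fintype.card Q * 2 ^ Fintype.card Q) := by
  classical
  by_contra! hlt
  have hcard : Fintype.card (Q × Set Q) = Fintype.card Q * 2 ^ Fintype.card Q := by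
    rw [Fintype.card_prod, Fintype.card_set]
  have hmono := h.strictMono
  obtain ⟨i, j, hij, hq⟩ := Fintype.exists_ne_map_eq_of_card_lt
    (fun i : Fin (Fintype.card Q * 2 ^ Fintype.card Q + 1) => withRest q e (g (n + i)))
    (by rw [hcard]; simp)
  have key : ∀ i j : Fin (Fintype.card Q * 2 ^ Fintype.card Q + 1), i < j →
      withRest q e (g (n + i)) ≠ withRest q e (g (n + j)) := by
    intro i j hij hq
    have hi : g n ≤ g (n + i) := hmono.monotone (by omega)
    have hj : g (n + j) ≤ g (n + Fintype.card Q * 2 ^ Fintype.card Q) :=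
      hmono.monotone (by omega)
    have hij' : g (n + i) < g (n + j) := hmono (by omega)
    exact h.last (n + i) (g (n + j)) hij' (by
      rw [(he (g n)).2 _ hi (by omega)]; omega) hq.symm
  rcases lt_or_gt_of_ne hij with hij | hij
  · exact key i j hij hq
  · exact key j i hij hq.symm

end IsContraction

/-- Bounded waiting times can be made bounded by a number that depends on the number of states
only. -/
theorem exists_reindexing_wait [Fintype Q] (q : ℕ → Q) {k : ℕ} (hk : 0 < k) (l : ℕ) :
    ∃ g, Reindexing q g k (2 * (Fintype.card Q * 2 ^ Fintype.card Q)) ((l + 1) * k) l := by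
  have he := isBlockEnd_div hk
  obtain ⟨g, hg⟩ := exists_isContraction q he
  have hmono := hg.strictMono.monotone
  refine ⟨g, congrArg Prod.fst hg.zero, fun n => congrArg Prod.fst (hg.succ n), ?_, ?_, ?_⟩
  · intro n x hx
    obtain ⟨m, hm, hq, -⟩ := hg.exists_visit he n x hx
    exact ⟨m, hm, hq⟩
  · intro n x hx hxk
    obtain ⟨m, hm, hq, hlt⟩ := hg.exists_visit he n x hx
    refine ⟨m - n, ?_, by rw [Nat.add_sub_cancel' hm]; exact hq⟩
    -- As `x ≤ g n + k`, it lies in the block of `g n` or the next one; each of them is left after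
    -- at most `N` steps.
    set N := Fintype.card Q * 2 ^ Fintype.card Q
    by_contra! hlt'
    have h1 : g (n + N + N) ≤ g m := hmono (by omega)
    have h2 := hg.blockEnd_le he (n + N)
    have h3 := hg.blockEnd_le he n
    have h4 : (g n / k + 1) * k ≤ g (n + N) := h3
    have h5 : (g (n + N) / k + 1) * k ≤ g (n + N + N) := h2
    have h6 : g n / k + 1 ≤ g (n + N) / k := (Nat.le_div_iff_mul_le hk).2 h4
    have h7 : x / k ≤ g n / k + 1 := by
      rw [← Nat.add_div_right _ hk]; exact Nat.div_le_div_right hxk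
    have h8 : (x / k + 1) * k ≤ (g (n + N) / k + 1) * k := Nat.mul_le_mul_right _ (by omega)
    change g m < (x / k + 1) * k at hlt
    omega
  · intro n j hj
    refine ⟨g (n + j), hmono (by omega), ?_, rfl⟩
    -- `g (n + 1)` lies in the block of `g n + 1`, so a step enters at most one new block.
    have key : ∀ j, g (n + j) / k ≤ g n / k + j := by
      intro j
      induction j with
      | zero => simp
      | succ j ih =>
        have h1 := hg.succ_lt (n + j)
        have h2 : g (n + j + 1) / k < (g (n + j) + 1) / k + 1 :=
          Nat.div_lt_of_lt_mul (by simpa [mul_comm] using h1)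
        have h3 : (g (n + j) + 1) / k ≤ g (n + j) / k + 1 := by
          rw [← Nat.add_div_right _ hk]; exact Nat.div_le_div_right (by omega)
        rw [← add_assoc]
        omega
    have h1 := key j
    have h2 := Nat.div_add_mod (g (n + j)) k
    have h2' := Nat.mod_lt (g (n + j)) hk
    have h3 := Nat.div_add_mod (g n) k
    have h4 : k * (g (n + j) / k) ≤ k * (g n / k + l) := Nat.mul_le_mul_left _ (by omega)
    have h5 : (l + 1) * k = k * l + k := by ring
    rw [mul_add] at h4
    omega

end Blocks

/-! ### Windows, which preserve short distances exactly -/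

section Windows

variable {Q : Type*} {q : ℕ → Q} {g : ℕ → ℕ}

/-- The states at the next `W + 1` positions. -/
def window (q : ℕ → Q) (W n : ℕ) : Fin (W + 1) → Q := fun j => q (n + j)

theorem window_apply_zero (q : ℕ → Q) (W n : ℕ) : window q W n 0 = q n := by simp [window]

theorem eq_of_window_eq {W m n : ℕ} (h : window q W m = window q W n) : q m = q n := by
  simpa [window_apply_zero] using congrFun h 0

/-- Each step moves to a position with the same window as the true successor, so what was predicted
`j - i` positions ahead after `i` steps does not change with `i`. -/
theorem apply_add_of_window {W : ℕ}
    (h : ∀ n, window q W (g (n + 1)) = window q W (g n + 1)) (n j : ℕ) (hj : j ≤ W) :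
    q (g (n + j)) = q (g n + j) := by
  have key : ∀ i ≤ j, q (g (n + i) + (j - i)) = q (g n + j) := by
    intro i
    induction i with
    | zero => simp
    | succ i ih =>
      intro hi
      rw [← ih (by omega)]
      have := congrFun (h (n + i)) ⟨j - (i + 1), by omega⟩
      simp only [window] at this
      rw [← add_assoc, this]
      congr 1
      omega
  simpa using key j le_rfl

end Windows

/-! ### Lassos of bounded size -/

section Loop

/-- Positions of the infinite unravelling of a lasso with `m` positions and the loop `[t, m)`. -/
def fold (t m n : ℕ) : ℕ := if n < m then n else t + (n - t) % (m - t)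

theorem fold_of_lt {t m n : ℕ} (h : n < m) : fold t m n = n := if_pos h

theorem fold_lt {t m : ℕ} (h : t < m) (n : ℕ) : fold t m n < m := by
  unfold fold
  split_ifs with h'
  · exact h'
  · have := Nat.mod_lt (n - t) (show 0 < m - t by omega)
    omega

theorem fold_succ {t m : ℕ} (h : t < m) (n : ℕ) :
    fold t m (n + 1) = if fold t m n + 1 < m then fold t m n + 1 else t := by
  unfold fold
  have hmod := Nat.mod_lt (n - t) (show 0 < m - t by omega)
  by_cases h1 : n + 1 < m
  · simp [h1, show n < m by omega]
  by_cases h2 : n < m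
  · have : n + 1 = m := by omega
    subst this
    simp
  · simp only [h1, h2, if_false]
    have h3 : n + 1 - t = n - t + 1 := by omega
    rw [h3, Nat.add_mod_eq_ite]
    by_cases h5 : m - t = 1
    · rw [h5]; simp [Nat.mod_one]; omega
    · rw [Nat.mod_eq_of_lt (show 1 < m - t by omega)]
      split_ifs <;> omega

theorem fold_add_mul {t m : ℕ} (h : t < m) {n : ℕ} (hn : t ≤ n) (c : ℕ) :
    fold t m (n + c * (m - t)) = fold t m n := by
  unfold fold
  by_cases h1 : n < m
  · rcases Nat.eq_zero_or_pos c with rfl | hc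
    · simp
    · have : m - t ≤ c * (m - t) := Nat.le_mul_of_pos_left _ hc
      rw [if_neg (by omega), if_pos h1, show n + c * (m - t) - t = n - t + c * (m - t) by omega,
        Nat.add_mul_mod_self_right, Nat.mod_eq_of_lt (by omega)]
      omega
  · rw [if_neg (by omega), if_neg h1, show n + c * (m - t) - t = n - t + c * (m - t) by omega,
      Nat.add_mul_mod_self_right]

theorem le_fold {t m : ℕ} {n : ℕ} (hn : t ≤ n) : t ≤ fold t m n := by
  unfold fold; split_ifs <;> omega

variable {Q : Type*} [Finite Q]

/-- Take `s` beyond all occurrences of the values that occur finitely often, and `t` a return of the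
value at `s` late enough that every remaining value has been seen. Positivity of `s` gives it a
predecessor, from which the loop is entered. -/
theorem exists_recurrent (q : ℕ → Q) :
    ∃ s t, 0 < s ∧ s < t ∧ q s = q t ∧ ∀ x, s ≤ x → ∃ y, s ≤ y ∧ y < t ∧ q y = q x := by
  have h1 : ∀ v : Q, ∃ S, ∀ x, S ≤ x → q x = v → ∀ n, ∃ y, n ≤ y ∧ q y = v := by
    intro v
    by_cases h : ∀ n, ∃ y, n ≤ y ∧ q y = v
    · exact ⟨0, fun _ _ _ => h⟩
    · push Not at h
      obtain ⟨S, hS⟩ := h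
      exact ⟨S, fun x hx hq => absurd hq (hS x hx)⟩
  choose S hS using h1
  obtain ⟨s, hs⟩ := (Set.finite_range S).bddAbove
  have hrec : ∀ x, s ≤ x → ∀ n, ∃ y, n ≤ y ∧ q y = q x := fun x hx =>
    hS (q x) x ((hs ⟨_, rfl⟩).trans hx) rfl
  have h2 : ∀ v : Q, ∃ T, (∃ x, s + 1 ≤ x ∧ q x = v) → ∃ y, s + 1 ≤ y ∧ y < T ∧ q y = v := by
    intro v
    by_cases h : ∃ x, s + 1 ≤ x ∧ q x = v
    · obtain ⟨x, hx⟩ := h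
      exact ⟨x + 1, fun _ => ⟨x, hx.1, by omega, hx.2⟩⟩
    · exact ⟨0, fun h' => absurd h' h⟩
  choose T hT using h2
  obtain ⟨t, ht⟩ := (Set.finite_range T).bddAbove
  obtain ⟨t', ht', hq⟩ := hrec (s + 1) (by omega) (t + s + 2)
  refine ⟨s + 1, t', by omega, by omega, hq.symm, fun x hx => ?_⟩
  obtain ⟨y, hy1, hy2, hy3⟩ := hT (q x) ⟨x, hx, rfl⟩
  have := ht ⟨q x, rfl⟩
  exact ⟨y, hy1, by omega, hy3⟩

end Loop

variable {Q : Type*}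

/-- Every sequence over a finite set can be reindexed to a lasso of bounded size. -/
theorem exists_reindexing_lasso [Fintype Q] (q : ℕ → Q) (W : ℕ) :
    ∃ g t m, t < m ∧
      m ≤ 2 * (Fintype.card Q ^ (W + 1) * 2 ^ (Fintype.card Q ^ (W + 1))) ∧
      (∀ n, g (fold t m n) = g n) ∧ ∀ k ≤ W, ∀ l ≤ W, Reindexing q g k k l l := by
  obtain ⟨s, t, hs, hst, hqst, hrec⟩ := exists_recurrent (window q W)
  -- The blocks `[0, s)` and `[s, t)` are contracted to the stem and the loop; the later singleton
  -- blocks play no role.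
  set e : ℕ → ℕ := fun i => if i < s then s else if i < t then t else i + 1 with he_def
  have he : IsBlockEnd e := by
    intro i
    refine ⟨by simp only [e]; split_ifs <;> omega, fun j h1 h2 => ?_⟩
    simp only [e] at h2 ⊢
    split_ifs at h2 ⊢ <;> omega
  obtain ⟨g, hg⟩ := exists_isContraction (window q W) he
  have hmono := hg.strictMono
  have hcard : Fintype.card (Fin (W + 1) → Q) = Fintype.card Q ^ (W + 1) := by simp
  set N := Fintype.card Q ^ (W + 1) * 2 ^ (Fintype.card Q ^ (W + 1)) with hN
  have hble : ∀ n, e (g n) ≤ g (n + N) := by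
    intro n
    have := hg.blockEnd_le he n
    rwa [hcard] at this
  -- the first visited position at or after a block boundary `c`
  have hfirst : ∀ c, 0 < c → (∀ i, i < c → e i ≤ c) → ∃ r, 0 < r ∧ g (r - 1) + 1 = c ∧
      ∀ n, n < r ↔ g n < c := by
    intro c hc hec
    have hex : ∃ r, c ≤ g r := ⟨c, hmono.le_apply⟩
    classical
    have h1 : c ≤ g (Nat.find hex) := Nat.find_spec hex
    have h2 : ∀ n, n < Nat.find hex ↔ g n < c := by
      intro n
      constructor
      · intro hn; have := Nat.find_min hex hn; omega
      · intro hn; by_contra! hle; have := hmono.monotone hle; omega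
    have h3 : 0 < Nat.find hex := (h2 0).2 (hg.zero_lt.trans_le (hec 0 hc))
    refine ⟨Nat.find hex, h3, ?_, h2⟩
    have h4 := (h2 (Nat.find hex - 1)).1 (by omega)
    by_contra! hne
    have h5 := hg.succ_lt (Nat.find hex - 1)
    have h6 := hec (g (Nat.find hex - 1) + 1) (by omega)
    rw [Nat.sub_add_cancel h3] at h5
    omega
  obtain ⟨r, hr0, hrs, hr⟩ := hfirst s hs (fun i hi => by simp [e, hi])
  obtain ⟨m, hm0, hmt, hm⟩ := hfirst t (by omega) (fun i hi => by
    simp only [e]; split_ifs <;> omega)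
  have hrm : r < m := (hm r).2 (by
    have h := hg.succ_lt (r - 1)
    rw [Nat.sub_add_cancel hr0, hrs] at h
    simpa [e, hst] using h)
  have hgr : e (g r) = t := by
    have h1 : ¬ g r < s := fun h => by have := (hr r).2 h; omega
    have h2 := (hm r).1 hrm
    simp [e, h1, h2]
  have hmN : m ≤ 2 * N := by
    have h1 := hble 0
    have h2 := hble r
    rw [hgr] at h2
    have h3 : e (g 0) = s := by
      have := (hr 0).1 hr0
      simp [e, this]
    rw [h3] at h1
    have h4 : r ≤ 0 + N := by
      by_contra! h; have := (hr _).1 h; omega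
    have h5 : m ≤ r + N := by
      by_contra! h; have := (hm _).1 h; omega
    omega
  -- At the end of the loop the true successor is `t`. Its window is that of `s`, which is also the
  -- window at `g r`, where the loop starts again.
  have hstep : ∀ n, window q W (g (fold r m (n + 1))) = window q W (g (fold r m n) + 1) := by
    intro n
    rw [fold_succ hrm]
    split_ifs with h
    · exact congrArg Prod.fst (hg.succ _)
    · have h1 := fold_lt hrm n
      have h2 : fold r m n = m - 1 := by omega
      rw [h2, hmt, ← hqst, ← hrs]
      have := congrArg Prod.fst (hg.succ (r - 1))
      rwa [Nat.sub_add_cancel hr0] at this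
  refine ⟨fun n => g (fold r m n), r, m, hrm, hmN,
    fun n => by simp only [fold_of_lt (fold_lt hrm n)], fun k hk l hl => ?_⟩
  have hexact := apply_add_of_window (g := fun n => g (fold r m n)) hstep
  refine ⟨?_, fun n => eq_of_window_eq (hstep n), ?_, ?_, ?_⟩
  · rw [fold_of_lt hm0]
    exact eq_of_window_eq (congrArg Prod.fst hg.zero)
  · intro n x hx
    change g (fold r m n) ≤ x at hx
    by_cases hxs : x < s
    · have h1 : fold r m n < r := (hr _).2 (by omega)
      have h2 : fold r m n = n := by
        by_contra hne
        have : ¬ n < m := fun h => hne (fold_of_lt h)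
        have := le_fold (t := r) (m := m) (n := n) (by omega)
        omega
      obtain ⟨μ, h3, h4, h5⟩ := hg.exists_visit he _ x hx
      refine ⟨μ, by omega, ?_⟩
      have h6 : μ < m := (hm _).2 (by simp only [e, hxs, if_true] at h5; omega)
      simp only [fold_of_lt h6]
      exact eq_of_window_eq h4
    -- The window of `x` occurs in `[s, t)`, hence among the states ahead of `g r` in its block,
    -- hence inside the loop; adding `n` turns of the loop moves the visit beyond `n`.
    · obtain ⟨y, hy1, hy2, hy3⟩ := hrec x (by omega)
      have hmem : window q W y ∈ (withRest (window q W) e s).2 :=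
        ⟨y, ⟨hy1, by simpa [e, hst] using hy2⟩, rfl⟩
      have h1 := hg.succ (r - 1)
      rw [Nat.sub_add_cancel hr0, hrs] at h1
      rw [← h1] at hmem
      obtain ⟨z, ⟨hz1, hz2⟩, hz3⟩ := hmem
      rw [hgr] at hz2
      obtain ⟨μ, h3, h4, h5⟩ := hg.exists_visit he r z hz1
      have h6 : e z = t := by
        have := (he (g r)).2 z hz1 (by omega)
        omega
      refine ⟨μ + n * (m - r), ?_, ?_⟩
      · have : n ≤ n * (m - r) := Nat.le_mul_of_pos_right _ (by omega)
        omega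
      · have h7 : μ < m := (hm _).2 (by omega)
        simp only [fold_add_mul hrm h3, fold_of_lt h7]
        exact eq_of_window_eq (h4.trans (hz3.trans hy3))
  · intro n x hx hxk
    change g (fold r m n) ≤ x at hx
    change x ≤ g (fold r m n) + k at hxk
    refine ⟨x - g (fold r m n), by omega, ?_⟩
    have := hexact n (x - g (fold r m n)) (by omega)
    rw [this]
    congr 1; omega
  · intro n j hj
    exact ⟨g (fold r m n) + j, by simp, by simpa using hj, hexact n j (by omega)⟩

/-! ### Pumping blocks, so that prompt eventualities stay unmet -/

/-- The position in a block of a sequence whose `[a, b)`-part is repeated for `X` further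
positions. -/
def pumpOffset (a b X o : ℕ) : ℕ :=
  if o < a then o else if o < b + X then a + (o - a) % (b - a) else o - X

theorem pumpOffset_spec {a b X M o : ℕ} (hab : a < b) (hbM : b < M) (hX : b - a ∣ X)
    (ho : o < M + X) :
    pumpOffset a b X o < M ∧
    (o + 1 < M + X → (pumpOffset a b X (o + 1) = pumpOffset a b X o + 1 ∨
      pumpOffset a b X o + 1 = b ∧ pumpOffset a b X (o + 1) = a)) ∧
    (o + 1 = M + X → pumpOffset a b X o + 1 = M) := by
  unfold pumpOffset
  have hmod := Nat.mod_lt (o - a) (show 0 < b - a by omega)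
  refine ⟨by split_ifs <;> omega, fun ho' => ?_, fun h => ?_⟩
  · by_cases h1 : o + 1 < a
    · left; simp [h1, show o < a by omega]
    by_cases h2 : o < a
    · have : o + 1 = a := by omega
      left
      rw [if_neg h1, if_pos h2, if_pos (by omega), this]; simp
    by_cases h3 : o + 1 < b + X
    · rw [if_neg h1, if_neg h2, if_pos h3, if_pos (by omega),
        show o + 1 - a = o - a + 1 by omega, Nat.add_mod_eq_ite]
      by_cases h5 : b - a = 1
      · rw [h5]; simp [Nat.mod_one]; omega
      · rw [Nat.mod_eq_of_lt (show 1 < b - a by omega)]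
        split_ifs <;> omega
    by_cases h4 : o < b + X
    · left
      rw [if_neg h1, if_neg h2, if_neg h3, if_pos h4]
      obtain ⟨c, hc⟩ := hX
      have h5 : o - a = b - a - 1 + (b - a) * c := by omega
      rw [h5, Nat.add_mul_mod_self_left, Nat.mod_eq_of_lt (by omega)]
      omega
    · left
      rw [if_neg h1, if_neg h2, if_neg h3, if_neg h4]
      omega
  · rw [if_neg (by omega), if_neg (by omega)]
    omega

/-- If invariants hold for sufficiently long, then they can be made to hold for any time. -/
theorem exists_reindexing_hold [Fintype Q] (q : ℕ → Q) (K l : ℕ) :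
    ∃ g, Reindexing q g K K
      (2 * (Fintype.card Q ^ (K + 1) * 2 ^ (Fintype.card Q ^ (K + 1)) + 2)) l := by
  classical
  set N := Fintype.card Q ^ (K + 1) * 2 ^ (Fintype.card Q ^ (K + 1)) with hN
  set M := N + 2 with hM
  have hM0 : 0 < M := by omega
  have he := isBlockEnd_div hM0
  set e : ℕ → ℕ := fun i => (i / M + 1) * M with he_def
  have hcard : Fintype.card ((Fin (K + 1) → Q) × Set (Fin (K + 1) → Q)) = N := by
    simp [Fintype.card_set, hN]
  -- A block has more positions than there are pairs. Repeating the window makes `[a, b)` a cycle;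
  -- repeating the rest set as well means that jumping back exposes no state that was not still
  -- ahead. With `b < M` the block boundary is crossed by an ordinary step.
  have hpig : ∀ c, ∃ a b, a < b ∧ b < M ∧
      withRest (window q K) e (c * M + a) = withRest (window q K) e (c * M + b) := by
    intro c
    obtain ⟨i, j, hij, hq⟩ := Fintype.exists_ne_map_eq_of_card_lt
      (fun i : Fin (N + 1) => withRest (window q K) e (c * M + i)) (by rw [hcard]; simp)
    rcases lt_or_gt_of_ne hij with h | h
    · exact ⟨i, j, h, by omega, hq⟩
    · exact ⟨j, i, h, by omega, hq.symm⟩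
  choose a b hab hbM hq using hpig
  -- A common multiple of all cycle lengths that is at least `l`, so that all pumped blocks have the
  -- same length `M'`.
  obtain ⟨X, hX⟩ : ∃ X, X = l * M.factorial := ⟨_, rfl⟩
  have hdvd : ∀ c, b c - a c ∣ X := fun c => hX ▸
    (Nat.dvd_factorial (by have := hab c; omega) (by have := hbM c; omega)).mul_left _
  have hlX : l ≤ X := hX ▸ Nat.le_mul_of_pos_right _ (Nat.factorial_pos _)
  obtain ⟨M', hM'⟩ : ∃ M', M' = M + X := ⟨_, rfl⟩
  have hM'0 : 0 < M' := by omega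
  set g : ℕ → ℕ := fun n =>
    n / M' * M + pumpOffset (a (n / M')) (b (n / M')) X (n % M') with hg
  have hlt : ∀ n, pumpOffset (a (n / M')) (b (n / M')) X (n % M') < M := fun n =>
    (pumpOffset_spec (hab _) (hbM _) (hdvd _) ((Nat.mod_lt n hM'0).trans_eq hM')).1
  have hblk : ∀ n, g n / M = n / M' := by
    intro n
    rw [hg]
    simp only
    rw [mul_comm, Nat.mul_add_div hM0, Nat.div_eq_of_lt (hlt n), add_zero]
  -- the three kinds of steps
  have hsteps : ∀ n, (g (n + 1) = g n + 1 ∧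
        ((n + 1) / M' = n / M' → (g n + 1) / M = n / M')) ∨
      (g (n + 1) ≤ g n ∧ (g n + 1) / M = n / M' ∧
        withRest (window q K) e (g (n + 1)) = withRest (window q K) e (g n + 1)) := by
    intro n
    have hspec := pumpOffset_spec (hab (n / M')) (hbM _) (hdvd _) ((Nat.mod_lt n hM'0).trans_eq hM')
    rw [← hM'] at hspec
    have h0 := Nat.div_add_mod n M'
    by_cases h1 : n % M' + 1 < M'
    · have hd : (n + 1) / M' = n / M' := by
        conv_lhs => rw [← h0, add_assoc, Nat.mul_add_div hM'0, Nat.div_eq_of_lt h1, add_zero]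
      have hm : (n + 1) % M' = n % M' + 1 := by
        conv_lhs => rw [← h0, add_assoc, Nat.mul_add_mod, Nat.mod_eq_of_lt h1]
      rcases hspec.2.1 h1 with h2 | ⟨h2, h3⟩
      · left
        have h4 : g (n + 1) = g n + 1 := by simp only [hg, hd, hm, h2]; omega
        exact ⟨h4, fun h => by rw [← h4, hblk, h]⟩
      · right
        have h4 : g (n + 1) = n / M' * M + a (n / M') := by simp only [hg, hd, hm, h3]
        have h5 : g n + 1 = n / M' * M + b (n / M') := by
          have : g n = n / M' * M + pumpOffset (a (n / M')) (b (n / M')) X (n % M') := rfl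
          omega
        refine ⟨?_, ?_, by rw [h4, h5]; exact hq _⟩
        · have := hab (n / M'); omega
        · rw [h5, mul_comm, Nat.mul_add_div hM0, Nat.div_eq_of_lt (hbM _), add_zero]
    · left
      have h2 : n % M' + 1 = M' := by have := Nat.mod_lt n hM'0; omega
      have h3 : n + 1 = (n / M' + 1) * M' := by
        rw [mul_comm, mul_add, mul_one]; omega
      have hd : (n + 1) / M' = n / M' + 1 := by rw [h3, Nat.mul_div_cancel _ hM'0]
      have hm : (n + 1) % M' = 0 := by rw [h3, Nat.mul_mod_left]
      have h4 := hspec.2.2 h2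
      have h5 : pumpOffset (a (n / M' + 1)) (b (n / M' + 1)) X 0 = 0 := by
        unfold pumpOffset
        split_ifs with h6 h7
        · rfl
        · simp; omega
        · simp
      refine ⟨?_, fun h => by omega⟩
      simp only [hg, hd, hm, h5]
      rw [add_mul]; omega
  have hsucc : ∀ n, withRest (window q K) e (g (n + 1)) = withRest (window q K) e (g n + 1) := by
    intro n
    rcases hsteps n with ⟨h, -⟩ | ⟨-, -, h⟩
    · rw [h]
    · exact h
  have hexact := apply_add_of_window (fun n => congrArg Prod.fst (hsucc n))
  -- Within a block the set of states ahead never grows: ordinary steps shrink it and jumps back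
  -- preserve it.
  have hrest : ∀ n j, (n + j) / M' = n / M' →
      (withRest (window q K) e (g (n + j))).2 ⊆ (withRest (window q K) e (g n)).2 := by
    intro n j
    induction j with
    | zero => simp
    | succ j ih =>
      intro hj
      have h1 : (n + j) / M' = n / M' := le_antisymm
        ((Nat.div_le_div_right (by omega)).trans hj.le) (Nat.div_le_div_right (by omega))
      refine subset_trans ?_ (ih h1)
      rw [← add_assoc, hsucc (n + j)]
      have h2 : (g (n + j) + 1) / M = g (n + j) / M := by
        rw [hblk]
        rcases hsteps (n + j) with ⟨-, h⟩ | ⟨-, h, -⟩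
        · exact h (by rw [h1, ← hj, add_assoc])
        · exact h
      simp only [withRest, he_def, h2]
      exact Set.image_mono (Set.Ico_subset_Ico_left (by omega))
  refine ⟨g, ?_, fun n => eq_of_window_eq (congrArg Prod.fst (hsucc n)), ?_, ?_, ?_⟩
  · have : g 0 = 0 := by
      simp only [hg, Nat.zero_div, Nat.zero_mod, zero_mul, zero_add]
      unfold pumpOffset
      have := hab 0
      split_ifs <;> simp; omega
    rw [this]
  · intro n x hx
    -- `g` is unbounded and increases by at most 1 per step, so the first index from `n` on that
    -- reaches `x` hits it exactly.
    have hex : ∃ m, n ≤ m ∧ x ≤ g m := by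
      refine ⟨n + x * M', Nat.le_add_right _ _, ?_⟩
      have h1 : x ≤ (n + x * M') / M' := by
        rw [Nat.add_mul_div_right _ _ hM'0]; exact Nat.le_add_left _ _
      have h2 : (n + x * M') / M' ≤ g (n + x * M') := by
        simp only [hg]
        exact (Nat.le_mul_of_pos_right _ hM0).trans (Nat.le_add_right _ _)
      omega
    obtain ⟨h1, h2⟩ := Nat.find_spec hex
    refine ⟨Nat.find hex, h1, ?_⟩
    rcases h1.eq_or_lt with h3 | h3
    · rw [← h3] at h2 ⊢
      rw [le_antisymm hx h2]
    · have h4 := Nat.find_min hex (m := Nat.find hex - 1) (by omega)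
      have h5 : g (Nat.find hex) ≤ g (Nat.find hex - 1) + 1 := by
        have := hsteps (Nat.find hex - 1)
        rw [Nat.sub_add_cancel (by omega)] at this
        omega
      have : g (Nat.find hex) = x := by omega
      rw [this]
  · intro n x hx hxk
    refine ⟨x - g n, by omega, ?_⟩
    rw [hexact n _ (by omega)]
    congr 1; omega
  · intro n j hj
    -- Since `j ≤ l ≤ X < M'`, at most one boundary is crossed. The state is then found in the
    -- original block of `g n` or the next one, within `2 * M` positions.
    have h1 : (n + j) / M' ≤ n / M' + 1 := by
      rw [← Nat.add_div_right _ hM'0]; exact Nat.div_le_div_right (by omega)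
    have h2 : n / M' ≤ (n + j) / M' := Nat.div_le_div_right (by omega)
    have hgn : n / M' * M ≤ g n := Nat.le_add_right _ _
    rcases h2.eq_or_lt with h3 | h3
    · have hmem : window q K (g (n + j)) ∈ (withRest (window q K) e (g (n + j))).2 :=
        ⟨g (n + j), ⟨le_rfl, (he _).1⟩, rfl⟩
      obtain ⟨x, ⟨hx1, hx2⟩, hx3⟩ := hrest n j h3.symm hmem
      refine ⟨x, hx1, ?_, (eq_of_window_eq hx3).symm⟩
      simp only [he_def, hblk] at hx2
      rw [add_mul] at hx2
      omega
    · have h4 : (n + j) / M' = n / M' + 1 := by omega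
      have h5 : g (n + j) < n / M' * M + 2 * M := by
        have := hlt (n + j)
        have h6 : g (n + j) = (n + j) / M' * M +
          pumpOffset (a ((n + j) / M')) (b ((n + j) / M')) X ((n + j) % M') := rfl
        rw [h4, add_mul] at h6
        rw [h4] at this
        omega
      refine ⟨g (n + j), ?_, by omega, rfl⟩
      have := hlt n
      have h6 : g n = n / M' * M +
          pumpOffset (a (n / M')) (b (n / M')) X (n % M') := rfl
      have h7 : g (n + j) = (n + j) / M' * M +
          pumpOffset (a ((n + j) / M')) (b ((n + j) / M')) X ((n + j) % M') := rfl
      rw [h4, add_mul] at h7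
      omega

/-! ### Transfer of truth along reindexings -/

namespace Formula

theorem Sat.mono {w : ℕ → Set Atom} {φ : Formula} {k k' : ℕ} (hk : k ≤ k') :
    ∀ {n : ℕ}, φ.Sat w n k → φ.Sat w n k' := by
  induction φ with
  | atom a => exact id
  | natom a => exact id
  | next φ ih => exact ih
  | prompt φ ih => exact fun ⟨j, hj, h⟩ => ⟨j, hj.trans hk, ih h⟩
  | conj φ ψ ih₁ ih₂ => exact fun h => ⟨ih₁ h.1, ih₂ h.2⟩
  | disj φ ψ ih₁ ih₂ => exact fun h => h.imp ih₁ ih₂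
  | strongUntil φ ψ ih₁ ih₂ => exact fun ⟨j, hj, h⟩ => ⟨j, ih₂ hj, fun i hi => ih₁ (h i hi)⟩
  | release φ ψ ih₁ ih₂ =>
    exact fun h j => (h j).imp ih₂ fun ⟨i, hi, h'⟩ => ⟨i, hi, ih₁ h'⟩

/-- The expansion laws turn until and release into single steps, the form to which `Reindexing.succ`
applies. -/
theorem sat_strongUntil_iff {w : ℕ → Set Atom} {φ ψ : Formula} {n k : ℕ} :
    (strongUntil φ ψ).Sat w n k ↔
      ψ.Sat w n k ∨ φ.Sat w n k ∧ (strongUntil φ ψ).Sat w (n + 1) k := by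
  constructor
  · rintro ⟨_ | j, hj, h⟩
    · exact Or.inl hj
    · refine Or.inr ⟨by simpa using h 0 (by omega), j, ?_, fun i hi => ?_⟩
      · rwa [add_assoc, add_comm 1]
      · have := h (i + 1) (by omega)
        rwa [add_assoc, add_comm 1]
  · rintro (h | ⟨h, j, hj, h'⟩)
    · exact ⟨0, h, by simp⟩
    · refine ⟨j + 1, by rwa [add_comm j, ← add_assoc], ?_⟩
      rintro (_ | i) hi
      · exact h
      · have := h' i (by omega)
        rwa [add_comm i, ← add_assoc]

theorem sat_release_iff {w : ℕ → Set Atom} {φ ψ : Formula} {n k : ℕ} :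
    (release φ ψ).Sat w n k ↔
      ψ.Sat w n k ∧ (φ.Sat w n k ∨ (release φ ψ).Sat w (n + 1) k) := by
  constructor
  · intro h
    refine ⟨by simpa using h 0, ?_⟩
    by_contra! hc
    obtain ⟨hc1, hc2⟩ := hc
    apply hc2
    intro j
    refine (h (j + 1)).imp (fun h => by rwa [add_assoc, add_comm 1]) ?_
    rintro ⟨_ | i, hi, h'⟩
    · exact absurd h' hc1
    · exact ⟨i, by omega, by rwa [add_assoc, add_comm 1]⟩
  · rintro ⟨h, h'⟩ (_ | j)
    · exact Or.inl h
    · rcases h' with h' | h'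
      · exact Or.inr ⟨0, by omega, h'⟩
      · refine (h' j).imp (fun h => by rwa [add_comm j, ← add_assoc]) ?_
        rintro ⟨i, hi, h''⟩
        exact ⟨i + 1, by omega, by rwa [add_comm i, ← add_assoc]⟩

section

variable {Q : Type*} {q : ℕ → Q} {g : ℕ → ℕ} {k k' l l' c : ℕ} {w : ℕ → Set Atom}

/-- The clause `wait` handles the prompt operator and `fair` the witness of an until; `succ` does
the rest. Bounding codes by `c` covers all subformulas, because constituents have smaller codes. -/
theorem Sat.of_reindexing (h : Reindexing q g k k' l l')
    (hq : ∀ α : Formula, α.toNat ≤ c → ∀ i j, q i = q j → α.Sat w i k → α.Sat w j k)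
    (α : Formula) (hα : α.toNat ≤ c) : ∀ n, α.Sat w (g n) k → α.Sat (w ∘ g) n k' := by
  induction α with
  | atom a => exact fun n h => h
  | natom a => exact fun n h => h
  | next φ ih =>
    intro n hn
    have h1 := hα
    simp only [toNat] at h1
    exact ih (by omega) _ (hq φ (by omega) _ _ (h.succ n).symm hn)
  | prompt φ ih =>
    rintro n ⟨j, hj, hn⟩
    have h1 := hα
    simp only [toNat] at h1
    obtain ⟨j', hj', he⟩ := h.wait n (g n + j) (by omega) (by omega)
    exact ⟨j', hj', ih (by omega) _ (hq φ (by omega) _ _ he.symm hn)⟩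
  | conj φ ψ ih₁ ih₂ =>
    have h1 := hα
    simp only [toNat] at h1
    have h2 := Nat.left_le_pair φ.toNat ψ.toNat
    have h3 := Nat.right_le_pair φ.toNat ψ.toNat
    exact fun n hn => ⟨ih₁ (by omega) _ hn.1, ih₂ (by omega) _ hn.2⟩
  | disj φ ψ ih₁ ih₂ =>
    have h1 := hα
    simp only [toNat] at h1
    have h2 := Nat.left_le_pair φ.toNat ψ.toNat
    have h3 := Nat.right_le_pair φ.toNat ψ.toNat
    exact fun n hn => hn.imp (ih₁ (by omega) _) (ih₂ (by omega) _)
  | strongUntil φ ψ ih₁ ih₂ =>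
    have h1 := hα
    simp only [toNat] at h1
    have h2 := Nat.left_le_pair φ.toNat ψ.toNat
    have h3 := Nat.right_le_pair φ.toNat ψ.toNat
    intro n hn
    obtain ⟨x, hx, -⟩ := id hn
    obtain ⟨m, hm, he⟩ := h.fair n (g n + x) (by omega)
    have hψ : ψ.Sat w (g m) k := hq ψ (by omega) _ _ he.symm hx
    -- Only the visit at `m` is needed from now on: the until is unfolded along `g` until `n`
    -- reaches it.
    clear hx he
    induction hd : m - n generalizing n with
    | zero =>
      have : m = n := by omega
      subst this
      exact sat_strongUntil_iff.2 (Or.inl (ih₂ (by omega) _ hψ))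
    | succ d ih =>
      rw [sat_strongUntil_iff] at hn ⊢
      refine hn.imp (ih₂ (by omega) _) fun hn => ⟨ih₁ (by omega) _ hn.1, ?_⟩
      exact ih _ (hq (strongUntil φ ψ) hα _ _ (h.succ n).symm hn.2) (by omega) (by omega)
  | release φ ψ ih₁ ih₂ =>
    have h1 := hα
    simp only [toNat] at h1
    have h2 := Nat.left_le_pair φ.toNat ψ.toNat
    have h3 := Nat.right_le_pair φ.toNat ψ.toNat
    intro n hn j
    induction j generalizing n with
    | zero => exact Or.inl (ih₂ (by omega) _ (sat_release_iff.1 hn).1)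
    | succ j ih =>
      rcases (sat_release_iff.1 hn).2 with h' | h'
      · exact Or.inr ⟨0, by omega, ih₁ (by omega) _ h'⟩
      · refine (ih _ (hq (release φ ψ) hα _ _ (h.succ n).symm h')).imp
          (fun h => by rwa [add_comm j, ← add_assoc]) ?_
        rintro ⟨i, hi, h''⟩
        exact ⟨i + 1, by omega, by rwa [add_comm i, ← add_assoc]⟩

/-- Dual to `Sat.of_reindexing`: now `hold` handles the prompt operator, and `fair` preserves the
position that refutes a release. -/
theorem not_sat_of_reindexing (h : Reindexing q g k k' l l')
    (hq : ∀ α : Formula, α.toNat ≤ c → ∀ i j, q i = q j → α.Sat w i l → α.Sat w j l)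
    (α : Formula) (hα : α.toNat ≤ c) : ∀ n, ¬ α.Sat w (g n) l → ¬ α.Sat (w ∘ g) n l' := by
  induction α with
  | atom a => exact fun n h => h
  | natom a => exact fun n h => h
  | next φ ih =>
    intro n hn
    have h1 := hα
    simp only [toNat] at h1
    exact ih (by omega) _ fun h' => hn (hq φ (by omega) _ _ (h.succ n) h')
  | prompt φ ih =>
    rintro n hn ⟨j, hj, hn'⟩
    have h1 := hα
    simp only [toNat] at h1
    obtain ⟨x, hx, hx', he⟩ := h.hold n j hj
    refine ih (by omega) _ (fun h' => hn ⟨x - g n, by omega, ?_⟩) hn'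
    rw [Nat.add_sub_cancel' hx]
    exact hq φ (by omega) _ _ he h'
  | conj φ ψ ih₁ ih₂ =>
    have h1 := hα
    simp only [toNat] at h1
    have h2 := Nat.left_le_pair φ.toNat ψ.toNat
    have h3 := Nat.right_le_pair φ.toNat ψ.toNat
    intro n hn hn'
    exact hn ⟨not_imp_not.1 (ih₁ (by omega) _) hn'.1, not_imp_not.1 (ih₂ (by omega) _) hn'.2⟩
  | disj φ ψ ih₁ ih₂ =>
    have h1 := hα
    simp only [toNat] at h1
    have h2 := Nat.left_le_pair φ.toNat ψ.toNat
    have h3 := Nat.right_le_pair φ.toNat ψ.toNat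
    intro n hn hn'
    exact hn (hn'.imp (not_imp_not.1 (ih₁ (by omega) _)) (not_imp_not.1 (ih₂ (by omega) _)))
  | strongUntil φ ψ ih₁ ih₂ =>
    have h1 := hα
    simp only [toNat] at h1
    have h2 := Nat.left_le_pair φ.toNat ψ.toNat
    have h3 := Nat.right_le_pair φ.toNat ψ.toNat
    rintro n hn ⟨j, hj, hn'⟩
    induction j generalizing n with
    | zero =>
      exact ih₂ (by omega) _ (fun h' => hn (sat_strongUntil_iff.2 (Or.inl h'))) hj
    | succ j ih =>
      rw [sat_strongUntil_iff, not_or, not_and] at hn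
      refine ih (n + 1) (fun h' => hn.2 (not_imp_not.1 (ih₁ (by omega) _) (hn' 0 (by omega)))
        (hq (strongUntil φ ψ) hα _ _ (h.succ n) h')) ?_ fun i hi => ?_
      · rwa [add_assoc, add_comm 1]
      · have := hn' (i + 1) (by omega)
        rwa [add_assoc, add_comm 1]
  | release φ ψ ih₁ ih₂ =>
    have h1 := hα
    simp only [toNat] at h1
    have h2 := Nat.left_le_pair φ.toNat ψ.toNat
    have h3 := Nat.right_le_pair φ.toNat ψ.toNat
    intro n hn hn'
    have hx : ∃ x, ¬ ψ.Sat w (g n + x) l := by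
      by_contra! hc
      exact hn fun j => Or.inl (hc j)
    obtain ⟨x, hx⟩ := hx
    obtain ⟨m, hm, he⟩ := h.fair n (g n + x) (by omega)
    have hψ : ¬ ψ.Sat w (g m) l := fun h' => hx (hq ψ (by omega) _ _ he h')
    clear hx he
    induction hd : m - n generalizing n with
    | zero =>
      have : m = n := by omega
      subst this
      exact ih₂ (by omega) _ hψ (sat_release_iff.1 hn').1
    | succ d ih =>
      rw [sat_release_iff] at hn hn'
      have hψn := not_imp_not.1 (ih₂ (by omega) _) hn'.1
      have hφn : ¬ φ.Sat w (g n) l := fun h' => hn ⟨hψn, Or.inl h'⟩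
      refine ih (n + 1) (fun h' => hn ⟨hψn, Or.inr
        (hq (release φ ψ) hα _ _ (h.succ n) h')⟩)
        (hn'.2.resolve_left (ih₁ (by omega) _ hφn)) (by omega) (by omega)

end

end Formula

/-! ### Snapshots of words in the product -/

namespace Architecture

variable (A : Architecture) {b : Fin A.numSys → ℕ}
  (T : ∀ p, TransitionSystem (A.inpStar p) (A.outStar p) (Fin (b p)))

/-- The states of the processes after reading the first `n` letters of `w`. -/
def stateAt (w : ℕ → Set Atom) (n : ℕ) (p : Fin A.numSys) : Fin (b p) :=
  (T p).run (List.ofFn fun i : Fin n => {a : A.inpStar p | (a : Atom) ∈ w i})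

theorem stateAt_zero (w : ℕ → Set Atom) : A.stateAt T w 0 = fun p => (T p).init := rfl

theorem stateAt_succ (w : ℕ → Set Atom) (n : ℕ) :
    A.stateAt T w (n + 1) = fun p =>
      (T p).step (A.stateAt T w n p) {a : A.inpStar p | (a : Atom) ∈ w n} := by
  funext p
  rw [stateAt, List.ofFn_succ_last]
  simp [stateAt, TransitionSystem.run]

theorem mem_product_iff (w : ℕ → Set Atom) :
    w ∈ A.product (fun p => (T p).strategy) ↔ (∀ n, w n ⊆ A.props) ∧
      ∀ p n, {a : A.outStar p | (a : Atom) ∈ w n} = (T p).label (A.stateAt T w n p) := Iff.rfl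

/-- All that matters at a position of a word for the processes and for the truth of the two
formulas and of their subformulas. -/
def snapshot (φ ψ : Formula) (w : ℕ → Set Atom) (k l n : ℕ) :
    (∀ p, Fin (b p)) × Set (Fin (φ.toNat + 1)) × Set (Fin (ψ.toNat + 1)) :=
  (A.stateAt T w n, {c | (Formula.ofNat c).Sat w n k}, {c | (Formula.ofNat c).Sat w n l})

variable {φ ψ : Formula} {w : ℕ → Set Atom} {k k' l l' : ℕ} {g : ℕ → ℕ}

/-- The letter of `w ∘ g` at `n` is that of `w` at `g n`, so equal states give equal next states,
and `succ` identifies these with the states at `g (n + 1)`. -/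
theorem stateAt_comp (h : Reindexing (A.snapshot T φ ψ w k l) g k k' l l') (n : ℕ) :
    A.stateAt T (w ∘ g) n = A.stateAt T w (g n) := by
  induction n with
  | zero => exact (congrArg Prod.fst h.zero).symm
  | succ n ih =>
    rw [stateAt_succ, ih]
    have := congrArg Prod.fst (h.succ n)
    refine Eq.trans ?_ this.symm
    simp only [snapshot, stateAt_succ]
    rfl

theorem comp_mem_product (h : Reindexing (A.snapshot T φ ψ w k l) g k k' l l')
    (hw : w ∈ A.product (fun p => (T p).strategy)) :
    w ∘ g ∈ A.product (fun p => (T p).strategy) := by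
  rw [mem_product_iff] at hw ⊢
  refine ⟨fun n => hw.1 _, fun p n => ?_⟩
  rw [A.stateAt_comp T h]
  exact hw.2 p (g n)

theorem sat_comp (h : Reindexing (A.snapshot T φ ψ w k l) g k k' l l') (hφ : φ.Sat w 0 k) :
    φ.Sat (w ∘ g) 0 k' := by
  have hq : ∀ α : Formula, α.toNat ≤ φ.toNat → ∀ i j,
      A.snapshot T φ ψ w k l i = A.snapshot T φ ψ w k l j → α.Sat w i k → α.Sat w j k := by
    intro α hα i j he hs
    have h1 := congrArg (fun s => (⟨α.toNat, by omega⟩ : Fin (φ.toNat + 1)) ∈ s.2.1) he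
    simp only [snapshot, Set.mem_ofPred_eq, Formula.ofNat_toNat] at h1
    exact h1 ▸ hs
  exact Formula.Sat.of_reindexing h hq φ le_rfl 0 (hq φ le_rfl _ _ h.zero.symm hφ)

theorem not_sat_comp (h : Reindexing (A.snapshot T φ ψ w k l) g k k' l l')
    (hψ : ¬ ψ.Sat w 0 l) : ¬ ψ.Sat (w ∘ g) 0 l' := by
  have hq : ∀ α : Formula, α.toNat ≤ ψ.toNat → ∀ i j,
      A.snapshot T φ ψ w k l i = A.snapshot T φ ψ w k l j → α.Sat w i l → α.Sat w j l := by
    intro α hα i j he hs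
    have h1 := congrArg (fun s => (⟨α.toNat, by omega⟩ : Fin (ψ.toNat + 1)) ∈ s.2.2) he
    simp only [snapshot, Set.mem_ofPred_eq, Formula.ofNat_toNat] at h1
    exact h1 ▸ hs
  exact Formula.not_sat_of_reindexing h hq ψ le_rfl 0
    fun h' => hψ (hq ψ le_rfl _ _ h.zero h')

end Architecture

/-! ### Reduction to lassos of bounded size -/

/-- A bound on the waiting times of assumptions that suffices for `N` snapshots. -/
def waitBound (N : ℕ) : ℕ := 2 * (N * 2 ^ N)

/-- A bound for guarantees that suffices for `N` snapshots and the bound `K` for assumptions. -/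
def holdBound (N K : ℕ) : ℕ := 2 * (N ^ (K + 1) * 2 ^ (N ^ (K + 1)) + 2)

/-- A bound on the size of lassos that suffices for `N` snapshots and formula bounds up to `W`. -/
def lassoBound (N W : ℕ) : ℕ := 2 * (N ^ (W + 1) * 2 ^ (N ^ (W + 1)))

namespace Architecture

variable (A : Architecture) {b : Fin A.numSys → ℕ}
  (T : ∀ p, TransitionSystem (A.inpStar p) (A.outStar p) (Fin (b p)))

/-- The word `w` is ultimately periodic, with the period starting at `t` and ending at `m`, and
so are the states of the processes. -/
def IsLasso (w : ℕ → Set Atom) (t m : ℕ) : Prop :=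
  t < m ∧ ∀ n, w (fold t m n) = w n ∧ A.stateAt T w (fold t m n) = A.stateAt T w n

/-- A violation for `K` and `L` can be pumped to violate every `l` for `k = K`. Conversely, a
violation for some `k` and a sufficiently large `l` contracts to one for `K` and `L`, and then to a
lasso. -/
theorem satisfies_iff (φ ψ : Formula) {N K L : ℕ}
    (hN : N = (∏ p, b p) * (2 ^ (φ.toNat + 1) * 2 ^ (ψ.toNat + 1)))
    (hK : K = waitBound N) (hL : L = holdBound N K) :
    A.Satisfies (fun p => (T p).strategy) φ ψ ↔
      ¬ ∃ w ∈ A.product (fun p => (T p).strategy), ∃ t, ∃ m ≤ lassoBound N (K + L),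
        A.IsLasso T w t m ∧ φ.Sat w 0 K ∧ ¬ ψ.Sat w 0 L := by
  have hcard : Fintype.card
      ((∀ p, Fin (b p)) × Set (Fin (φ.toNat + 1)) × Set (Fin (ψ.toNat + 1))) = N := by
    simp [Fintype.card_set, hN]
  constructor
  · rintro h ⟨w, hw, t, m, -, -, hφ, hψ⟩
    obtain ⟨l, hl⟩ := h K
    obtain ⟨g, hg⟩ := exists_reindexing_hold (A.snapshot T φ ψ w K L) K l
    rw [hcard] at hg
    change Reindexing _ _ _ _ (holdBound N K) _ at hg
    rw [← hL] at hg
    exact A.not_sat_comp T hg hψ (hl _ (A.comp_mem_product T hg hw) (A.sat_comp T hg hφ))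
  · intro h k
    -- The guarantee bound that blocks of length `k + 1` shrink to `L`; `k + 1` replaces `k` because
    -- blocks must be nonempty.
    refine ⟨(L + 1) * (k + 1), fun w hw hφ => ?_⟩
    by_contra hψ
    obtain ⟨g, hg⟩ := exists_reindexing_wait
      (A.snapshot T φ ψ w (k + 1) ((L + 1) * (k + 1))) k.succ_pos L
    rw [hcard] at hg
    change Reindexing _ _ _ (waitBound N) _ _ at hg
    rw [← hK] at hg
    have hw' := A.comp_mem_product T hg hw
    have hφ' := A.sat_comp T hg (hφ.mono k.le_succ)
    have hψ' := A.not_sat_comp T hg hψ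
    generalize w ∘ g = v at hw' hφ' hψ'
    obtain ⟨g', t, m, htm, hm, hfold, hg'⟩ :=
      exists_reindexing_lasso (A.snapshot T φ ψ v K L) (K + L)
    rw [hcard] at hm
    replace hg' := hg' K (by omega) L (by omega)
    refine h ⟨v ∘ g', A.comp_mem_product T hg' hw', t, m, hm, ⟨htm, fun n => ?_⟩,
      A.sat_comp T hg' hφ', A.not_sat_comp T hg' hψ'⟩
    simp only [Function.comp, hfold, A.stateAt_comp T hg', true_and]

end Architecture

set_option linter.unusedVariables false

instance : LawfulBEq Atom where
  rfl {a} := by cases a <;> exact beq_self_eq_true (α := ℕ) _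
  eq_of_beq {a b} h := by
    cases a <;> cases b <;> first | exact congrArg _ (eq_of_beq (α := ℕ) h) | cases h

/-! ### Closure rules for primitive recursive functions -/

section PrimrecFunProp

variable {α β γ σ : Type*} [Primcodable α] [Primcodable β] [Primcodable γ] [Primcodable σ]

-- With these rules `fun_prop` follows the body of a definition, so the algorithms below are
-- composed of `cond`, `getD` with defaults and other total list operations.
attribute [fun_prop] Primrec
attribute [fun_prop] Primrec.id Primrec.const Primrec.comp Primrec.pair Primrec.option_some
  Primrec.list_length Primrec.list_range Primrec.sumInl Primrec.sumInr Primrec.not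
  Primrec.fst Primrec.snd Primrec.list_head?

@[fun_prop] theorem primrec_fst {f : α → β × γ} (hf : Primrec f) : Primrec fun a => (f a).1 :=
  Primrec.fst.comp hf

@[fun_prop] theorem primrec_snd {f : α → β × γ} (hf : Primrec f) : Primrec fun a => (f a).2 :=
  Primrec.snd.comp hf

section

variable {f g : α → ℕ}

@[fun_prop] theorem primrec_add (hf : Primrec f) (hg : Primrec g) :
    Primrec fun a => f a + g a := Primrec.nat_add.comp hf hg

@[fun_prop] theorem primrec_sub (hf : Primrec f) (hg : Primrec g) :
    Primrec fun a => f a - g a := Primrec.nat_sub.comp hf hg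

@[fun_prop] theorem primrec_mul (hf : Primrec f) (hg : Primrec g) :
    Primrec fun a => f a * g a := Primrec.nat_mul.comp hf hg

@[fun_prop] theorem primrec_div (hf : Primrec f) (hg : Primrec g) :
    Primrec fun a => f a / g a := Primrec.nat_div.comp hf hg

@[fun_prop] theorem primrec_mod (hf : Primrec f) (hg : Primrec g) :
    Primrec fun a => f a % g a := Primrec.nat_mod.comp hf hg

@[fun_prop] theorem primrec_pow (hf : Primrec f) (hg : Primrec g) :
    Primrec fun a => f a ^ g a :=
  (Primrec₂.unpaired'.1 Nat.Primrec.pow).comp hf hg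

@[fun_prop] theorem primrec_blt (hf : Primrec f) (hg : Primrec g) :
    Primrec fun a => Nat.blt (f a) (g a) :=
  (Primrec.nat_lt.comp hf hg).decide.of_eq fun a => by
    rw [Bool.eq_iff_iff]; simp [Nat.blt_eq]

end

@[fun_prop] theorem primrec_unpair {f : α → ℕ} (hf : Primrec f) :
    Primrec fun a => (f a).unpair := Primrec.unpair.comp hf

section

variable {f g : α → Bool}

@[fun_prop] theorem primrec_and (hf : Primrec f) (hg : Primrec g) :
    Primrec fun a => f a && g a := Primrec.and.comp hf hg

@[fun_prop] theorem primrec_or (hf : Primrec f) (hg : Primrec g) :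
    Primrec fun a => f a || g a := Primrec.or.comp hf hg

@[fun_prop] theorem primrec_not (hf : Primrec f) : Primrec fun a => !f a := Primrec.not.comp hf

@[fun_prop] theorem primrec_cond {h h' : α → β} (hf : Primrec f) (hh : Primrec h)
    (hh' : Primrec h') :
    Primrec fun a => cond (f a) (h a) (h' a) := Primrec.cond hf hh hh'

end

@[fun_prop] theorem primrec_beq [BEq β] [LawfulBEq β] {f g : α → β} (hf : Primrec f)
    (hg : Primrec g) : Primrec fun a => f a == g a := by
  classical
  exact (Primrec.eq.comp hf hg).decide.of_eq fun a => by rw [Bool.eq_iff_iff]; simp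

section

variable {f : α → List β}

@[fun_prop] theorem primrec_cons {g : α → β} (hf : Primrec f) (hg : Primrec g) :
    Primrec fun a => g a :: f a := Primrec.list_cons.comp hg hf

@[fun_prop] theorem primrec_append {g : α → List β} (hf : Primrec f) (hg : Primrec g) :
    Primrec fun a => f a ++ g a := Primrec.list_append.comp hf hg

@[fun_prop] theorem primrec_map {g : α → β → σ}
    (hf : Primrec f) (hg : Primrec fun x : α × β => g x.1 x.2) :
    Primrec fun a => (f a).map (g a) :=
  Primrec.list_map hf hg.to₂

@[fun_prop] theorem primrec_flatMap {g : α → β → List σ}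
    (hf : Primrec f) (hg : Primrec fun x : α × β => g x.1 x.2) :
    Primrec fun a => (f a).flatMap (g a) :=
  Primrec.list_flatMap hf hg.to₂

@[fun_prop] theorem primrec_foldr {g : α → β → σ → σ} {h : α → σ}
    (hf : Primrec f) (hg : Primrec fun x : α × β × σ => g x.1 x.2.1 x.2.2) (hh : Primrec h) :
    Primrec fun a => (f a).foldr (g a) (h a) :=
  Primrec.list_foldr (h := fun a s => g a s.1 s.2) hf hh hg.to₂

@[fun_prop] theorem primrec_getD {g : α → ℕ} {h : α → β}
    (hf : Primrec f) (hg : Primrec g) (hh : Primrec h) :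
    Primrec fun a => (f a).getD (g a) (h a) := by
  simp only [List.getD_eq_getElem?_getD]
  exact Primrec.option_getD.comp (Primrec.list_getElem?.comp hf hg) hh

@[fun_prop] theorem primrec_idxOf [BEq β] [LawfulBEq β] {g : α → β} (hf : Primrec f)
    (hg : Primrec g) : Primrec fun a => (f a).idxOf (g a) := by
  have h : Primrec fun x : α × β => x.2 == g x.1 := by fun_prop
  exact Primrec.list_findIdx hf h.to₂

@[fun_prop] theorem primrec_any {g : α → β → Bool}
    (hf : Primrec f) (hg : Primrec fun x : α × β => g x.1 x.2) :
    Primrec fun a => (f a).any (g a) := by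
  have h : Primrec fun a => (f a).foldr (fun b r => g a b || r) false := by
    have : Primrec fun x : α × β × Bool => g x.1 x.2.1 :=
      hg.comp (Primrec.fst.pair (Primrec.fst.comp Primrec.snd))
    fun_prop
  refine h.of_eq fun a => ?_
  induction f a with
  | nil => rfl
  | cons b l ih => simp [ih]

@[fun_prop] theorem primrec_all {g : α → β → Bool}
    (hf : Primrec f) (hg : Primrec fun x : α × β => g x.1 x.2) :
    Primrec fun a => (f a).all (g a) := by
  have h : Primrec fun a => !(f a).any (fun b => !g a b) := by fun_prop
  exact h.of_eq fun a => by simp [List.all_eq_not_any_not]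

@[fun_prop] theorem primrec_filter {g : α → β → Bool}
    (hf : Primrec f) (hg : Primrec fun x : α × β => g x.1 x.2) :
    Primrec fun a => (f a).filter (g a) := by
  have h : Primrec fun a => (f a).flatMap fun b => cond (g a b) [b] [] := by fun_prop
  refine h.of_eq fun a => ?_
  induction f a with
  | nil => rfl
  | cons b l ih => cases hb : g a b <;> simp [ih, hb]

@[fun_prop] theorem primrec_elem [BEq β] [LawfulBEq β] {g : α → β} (hf : Primrec f)
    (hg : Primrec g) : Primrec fun a => (f a).elem (g a) := by
  have h : Primrec fun a => (f a).any fun b => g a == b := by fun_prop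
  refine h.of_eq fun a => ?_
  rw [Bool.eq_iff_iff]
  simp

@[fun_prop] theorem primrec_sublists (hf : Primrec f) : Primrec fun a => (f a).sublists := by
  have h : Primrec fun a => (f a).foldr (fun b r => r.flatMap fun x => [x, b :: x]) [[]] := by
    fun_prop
  refine h.of_eq fun a => ?_
  induction f a with
  | nil => rfl
  | cons b l ih => rw [List.sublists_cons, List.foldr_cons, ih]; rfl

@[fun_prop] theorem primrec_sections {f : α → List (List β)} (hf : Primrec f) :
    Primrec fun a => (f a).sections := by
  have h : Primrec fun a =>
      (f a).foldr (fun l r => r.flatMap fun s => l.map fun b => b :: s) [[]] := by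
    fun_prop
  refine h.of_eq fun a => ?_
  induction f a with
  | nil => rfl
  | cons b l ih => rw [List.foldr_cons, ih]; rfl

end

@[fun_prop] theorem primrec_nat_rec {f : α → σ} {g : α → ℕ} {h : α → ℕ → σ → σ}
    (hf : Primrec f) (hg : Primrec g) (hh : Primrec fun x : α × ℕ × σ => h x.1 x.2.1 x.2.2) :
    Primrec fun a => (Nat.rec (f a) (h a) (g a) : σ) :=
  Primrec.nat_rec' (h := fun a s => h a s.1 s.2) hg hf hh.to₂

@[fun_prop] theorem primrec_formula_toNat {f : α → Formula} (hf : Primrec f) :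
    Primrec fun a => (f a).toNat := Primrec.encode.comp hf

@[fun_prop] theorem primrec_formula_ofNat {f : α → ℕ} (hf : Primrec f) :
    Primrec fun a => Formula.ofNat (f a) := (Primrec.ofNat Formula).comp hf

@[fun_prop] theorem primrec_ofNat_atom {f : α → ℕ} (hf : Primrec f) :
    Primrec fun a => Denumerable.ofNat Atom (f a) := (Primrec.ofNat Atom).comp hf

@[fun_prop] theorem primrec_fold {t m n : α → ℕ} (ht : Primrec t) (hm : Primrec m)
    (hn : Primrec n) : Primrec fun a => fold (t a) (m a) (n a) := by
  have h : Primrec fun a => cond (Nat.blt (n a) (m a)) (n a)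
    (t a + (n a - t a) % (m a - t a)) := by fun_prop
  refine h.of_eq fun a => ?_
  unfold fold
  cases hb : Nat.blt (n a) (m a)
  · rw [if_neg (by rw [← Nat.blt_eq, hb]; simp)]; rfl
  · rw [if_pos (by rwa [← Nat.blt_eq])]; rfl

end PrimrecFunProp

/-! ### Evaluation of formulas on a lasso -/

section Truth

variable {α : Type*} [Primcodable α]

/-- The truth values at all positions of a lasso of the formula that starts with the constructor
number `r`, from the truth values of its constituents. -/
def truthRow (w : List (List Atom)) (t k r : ℕ) (a : Atom) (x y : List Bool) : List Bool :=
  (List.range w.length).map fun i =>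
    cond (r == 0) ((w.getD i []).elem a) <|
    cond (r == 1) (!(w.getD i []).elem a) <|
    cond (r == 2) (x.getD (fold t w.length (i + 1)) false) <|
    cond (r == 3) ((List.range (k + 1)).any fun j => x.getD (fold t w.length (i + j)) false) <|
    cond (r == 4) (x.getD i false && y.getD i false) <|
    cond (r == 5) (x.getD i false || y.getD i false) <|
    cond (r == 6) ((List.range w.length).any fun j => y.getD (fold t w.length (i + j)) false &&
      (List.range j).all fun i' => x.getD (fold t w.length (i + i')) false)
    ((List.range w.length).all fun j => y.getD (fold t w.length (i + j)) false ||
      (List.range j).any fun i' => x.getD (fold t w.length (i + i')) false)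

/-- The truth values of a formula at all positions of a lasso. -/
def truth (w : List (List Atom)) (t k : ℕ) : Formula → List Bool
  | .atom a => truthRow w t k 0 a [] []
  | .natom a => truthRow w t k 1 a [] []
  | .next φ => truthRow w t k 2 (.inl 0) (truth w t k φ) []
  | .prompt φ => truthRow w t k 3 (.inl 0) (truth w t k φ) []
  | .conj φ ψ => truthRow w t k 4 (.inl 0) (truth w t k φ) (truth w t k ψ)
  | .disj φ ψ => truthRow w t k 5 (.inl 0) (truth w t k φ) (truth w t k ψ)
  | .strongUntil φ ψ => truthRow w t k 6 (.inl 0) (truth w t k φ) (truth w t k ψ)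
  | .release φ ψ => truthRow w t k 7 (.inl 0) (truth w t k φ) (truth w t k ψ)

/-- The truth values of the formula number `l.length`, from the list `l` of the truth values of
the formulas with smaller numbers. -/
def truthStep (w : List (List Atom)) (t k : ℕ) (l : List (List Bool)) : List Bool :=
  let n := l.length
  cond (n % 8 == 0) (truthRow w t k 0 (Denumerable.ofNat Atom (n / 8)) [] []) <|
  cond (n % 8 == 1) (truthRow w t k 1 (Denumerable.ofNat Atom (n / 8)) [] []) <|
  cond (n % 8 == 2) (truthRow w t k 2 (.inl 0) (l.getD (n / 8) []) []) <|
  cond (n % 8 == 3) (truthRow w t k 3 (.inl 0) (l.getD (n / 8) []) []) <|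
  truthRow w t k (n % 8) (.inl 0) (l.getD (n / 8).unpair.1 []) (l.getD (n / 8).unpair.2 [])

@[fun_prop] theorem primrec_truthRow {w : α → List (List Atom)} {t k r : α → ℕ} {a : α → Atom}
    {x y : α → List Bool} (hw : Primrec w) (ht : Primrec t) (hk : Primrec k) (hr : Primrec r)
    (ha : Primrec a) (hx : Primrec x) (hy : Primrec y) :
    Primrec fun i => truthRow (w i) (t i) (k i) (r i) (a i) (x i) (y i) := by
  unfold truthRow
  fun_prop

@[fun_prop] theorem primrec_truthStep {w : α → List (List Atom)} {t k : α → ℕ}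
    {l : α → List (List Bool)} (hw : Primrec w) (ht : Primrec t) (hk : Primrec k)
    (hl : Primrec l) :
    Primrec fun i => truthStep (w i) (t i) (k i) (l i) := by
  unfold truthStep
  fun_prop

/-- Evaluation becomes a course-of-values recursion on Gödel numbers: the constituents of formula
number `n` have numbers below `n`, so their rows are already in the list. -/
theorem truthStep_map_range (w : List (List Atom)) (t k n : ℕ) :
    truthStep w t k ((List.range n).map fun i => truth w t k (Formula.ofNat i)) =
      truth w t k (Formula.ofNat n) := by
  have hget : ∀ c, c < n → ((List.range n).map fun i => truth w t k (Formula.ofNat i)).getD c [] =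
      truth w t k (Formula.ofNat c) := by
    intro c hc
    simp [List.getD_eq_getElem?_getD, hc]
  have h1 := Nat.unpair_left_le (n / 8)
  have h2 := Nat.unpair_right_le (n / 8)
  have h8 : n % 8 < 8 := Nat.mod_lt _ (by omega)
  conv_rhs => rw [Formula.ofNat]
  unfold truthStep
  simp only [List.length_map, List.length_range]
  by_cases h : n % 8 < 2
  · interval_cases n % 8 <;> simp [truth]
  · rw [hget (n / 8) (by omega), hget _ (by omega), hget _ (by omega)]
    interval_cases n % 8 <;> first | omega | simp [truth]

@[fun_prop] theorem primrec_truth {w : α → List (List Atom)} {t k : α → ℕ} {φ : α → Formula}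
    (hw : Primrec w) (ht : Primrec t) (hk : Primrec k) (hφ : Primrec φ) :
    Primrec fun i => truth (w i) (t i) (k i) (φ i) := by
  have h : Primrec₂ fun (e : List (List Atom) × ℕ × ℕ) (n : ℕ) =>
      truth e.1 e.2.1 e.2.2 (Formula.ofNat n) := by
    refine Primrec.nat_strong_rec _
      (g := fun e l => some (truthStep e.1 e.2.1 e.2.2 l)) ?_ ?_
    · have : Primrec fun x : (List (List Atom) × ℕ × ℕ) × List (List Bool) =>
        some (truthStep x.1.1 x.1.2.1 x.1.2.2 x.2) := by fun_prop
      exact this.to₂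
    · intro e n
      rw [truthStep_map_range]
  refine (h.comp (hw.pair (ht.pair hk)) (primrec_formula_toNat hφ)).of_eq fun i => ?_
  rw [Formula.ofNat_toNat]

end Truth

/-! ### The algorithms on finite descriptions -/

section Codes

/-- The input letters of process number `p` with inputs `I`, in the order of `implCode`. -/
def inputLetters (p : ℕ) (I : List ℕ) : List (List Atom) :=
  ((Sum.inr p : Atom) :: I.map Sum.inl).sublists

/-- The transition systems with `b` states for process number `p` with inputs `I` and outputs `O`
that never change their state on an input letter without `sched_p`. -/
def processCandidates (p b : ℕ) (I O : List ℕ) : List (ℕ × List (List ℕ) × List (List ℕ)) :=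
  (List.range b).flatMap fun i =>
    (((List.range b).map fun s => ((inputLetters p I).map fun x =>
      cond (x.elem (Sum.inr p)) (List.range b) [s]).sections).sections).flatMap fun δ =>
        (((List.range b).map fun _ => O.sublists).sections).map fun o => (i, δ, o)

/-- The implementations of sizes `b` that never change the state of a process that is not
scheduled. -/
def candidates (a : ArchCode) (b : List ℕ) : List ImplCode :=
  ((List.range a.2.length).map fun p =>
    processCandidates p (b.getD p 0) (a.2.getD p ([], [])).1 (a.2.getD p ([], [])).2).sections

/-- The outputs of the environment. -/
def envAtoms (a : ArchCode) : List Atom :=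
  a.1.map Sum.inl ++ (List.range a.2.length).map Sum.inr

/-- The letter with the environment outputs `e` and the outputs of the processes in the
states `s`. -/
def letterOf (c : ImplCode) (s : List ℕ) (e : List Atom) : List Atom :=
  e ++ (List.range c.length).flatMap fun p =>
    ((c.getD p (0, [], [])).2.2.getD (s.getD p 0) []).map Sum.inl

/-- The states after the states `s` when the environment outputs are `e`. -/
def nextStates (a : ArchCode) (c : ImplCode) (s : List ℕ) (e : List Atom) : List ℕ :=
  (List.range c.length).map fun p =>
    ((c.getD p (0, [], [])).2.1.getD (s.getD p 0) []).getD
      ((inputLetters p (a.2.getD p ([], [])).1).idxOf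
        (((Sum.inr p : Atom) :: (a.2.getD p ([], [])).1.map Sum.inl).filter fun x =>
          (letterOf c s e).elem x)) 0

/-- The states after the first `n` environment outputs of `u`. -/
def statesCode (a : ArchCode) (c : ImplCode) (u : List (List Atom)) (n : ℕ) : List ℕ :=
  Nat.rec (c.map fun x => x.1) (fun i s => nextStates a c s (u.getD i [])) n

/-- The word that is produced when the environment outputs are `u`. -/
def wordCode (a : ArchCode) (c : ImplCode) (u : List (List Atom)) : List (List Atom) :=
  (List.range u.length).map fun i => letterOf c (statesCode a c u i) (u.getD i [])

/-- Whether the environment outputs `u`, repeated from position `t` on, give a lasso that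
satisfies `φ` for the bound `K` and does not satisfy `ψ` for the bound `L`. -/
def isCounterexample (a : ArchCode) (c : ImplCode) (φ ψ : Formula) (K L : ℕ)
    (u : List (List Atom)) (t : ℕ) : Bool :=
  (statesCode a c u t == statesCode a c u u.length) &&
    ((truth (wordCode a c u) t K φ).getD 0 false && !(truth (wordCode a c u) t L ψ).getD 0 false)

/-- Whether there is a lasso of size at most `B` that satisfies `φ` for the bound `K` and does
not satisfy `ψ` for the bound `L`. -/
def hasCounterexample (a : ArchCode) (c : ImplCode) (φ ψ : Formula) (K L B : ℕ) : Bool :=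
  (List.range (B + 1)).any fun m =>
    ((List.range m).map fun _ => (envAtoms a).sublists).sections.any fun u =>
      (List.range m).any fun t => isCounterexample a c φ ψ K L u t

/-- The number of snapshots for given sizes of the implementations. -/
def numSnapshots (b : List ℕ) (φ ψ : Formula) : ℕ :=
  b.foldr (fun x y => x * y) 1 * (2 ^ (φ.toNat + 1) * 2 ^ (ψ.toNat + 1))

/-- An implementation of the sizes `b` that realizes `(φ, ψ)`, if there is one. -/
def solve (x : ArchCode × (Formula × Formula) × List ℕ) : Option ImplCode :=
  cond (x.2.2.length == x.1.2.length)
    ((candidates x.1 x.2.2).filter fun c =>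
      !hasCounterexample x.1 c x.2.1.1 x.2.1.2
        (waitBound (numSnapshots x.2.2 x.2.1.1 x.2.1.2))
        (holdBound (numSnapshots x.2.2 x.2.1.1 x.2.1.2)
          (waitBound (numSnapshots x.2.2 x.2.1.1 x.2.1.2)))
        (lassoBound (numSnapshots x.2.2 x.2.1.1 x.2.1.2)
          (waitBound (numSnapshots x.2.2 x.2.1.1 x.2.1.2) +
            holdBound (numSnapshots x.2.2 x.2.1.1 x.2.1.2)
              (waitBound (numSnapshots x.2.2 x.2.1.1 x.2.1.2))))).head?
    none

variable {α : Type*} [Primcodable α]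

@[fun_prop] theorem primrec_inputLetters {p : α → ℕ} {I : α → List ℕ} (hp : Primrec p)
    (hI : Primrec I) : Primrec fun i => inputLetters (p i) (I i) := by
  unfold inputLetters
  fun_prop

@[fun_prop] theorem primrec_processCandidates {p b : α → ℕ} {I O : α → List ℕ} (hp : Primrec p)
    (hb : Primrec b) (hI : Primrec I) (hO : Primrec O) :
    Primrec fun i => processCandidates (p i) (b i) (I i) (O i) := by
  unfold processCandidates
  fun_prop

@[fun_prop] theorem primrec_candidates {a : α → ArchCode} {b : α → List ℕ} (ha : Primrec a)
    (hb : Primrec b) : Primrec fun i => candidates (a i) (b i) := by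
  unfold candidates
  fun_prop

@[fun_prop] theorem primrec_envAtoms {a : α → ArchCode} (ha : Primrec a) :
    Primrec fun i => envAtoms (a i) := by
  unfold envAtoms
  fun_prop

@[fun_prop] theorem primrec_letterOf {c : α → ImplCode} {s : α → List ℕ} {e : α → List Atom}
    (hc : Primrec c) (hs : Primrec s) (he : Primrec e) :
    Primrec fun i => letterOf (c i) (s i) (e i) := by
  unfold letterOf
  fun_prop

@[fun_prop] theorem primrec_nextStates {a : α → ArchCode} {c : α → ImplCode} {s : α → List ℕ}
    {e : α → List Atom} (ha : Primrec a) (hc : Primrec c) (hs : Primrec s) (he : Primrec e) :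
    Primrec fun i => nextStates (a i) (c i) (s i) (e i) := by
  unfold nextStates
  fun_prop

@[fun_prop] theorem primrec_statesCode {a : α → ArchCode} {c : α → ImplCode}
    {u : α → List (List Atom)} {n : α → ℕ} (ha : Primrec a) (hc : Primrec c) (hu : Primrec u)
    (hn : Primrec n) : Primrec fun i => statesCode (a i) (c i) (u i) (n i) := by
  unfold statesCode
  fun_prop

@[fun_prop] theorem primrec_wordCode {a : α → ArchCode} {c : α → ImplCode}
    {u : α → List (List Atom)} (ha : Primrec a) (hc : Primrec c) (hu : Primrec u) :
    Primrec fun i => wordCode (a i) (c i) (u i) := by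
  unfold wordCode
  fun_prop

@[fun_prop] theorem primrec_isCounterexample {a : α → ArchCode} {c : α → ImplCode}
    {φ ψ : α → Formula} {K L t : α → ℕ} {u : α → List (List Atom)} (ha : Primrec a)
    (hc : Primrec c) (hφ : Primrec φ) (hψ : Primrec ψ) (hK : Primrec K) (hL : Primrec L)
    (hu : Primrec u) (ht : Primrec t) :
    Primrec fun i => isCounterexample (a i) (c i) (φ i) (ψ i) (K i) (L i) (u i) (t i) := by
  unfold isCounterexample
  fun_prop

@[fun_prop] theorem primrec_hasCounterexample {a : α → ArchCode} {c : α → ImplCode}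
    {φ ψ : α → Formula} {K L B : α → ℕ} (ha : Primrec a)
    (hc : Primrec c) (hφ : Primrec φ) (hψ : Primrec ψ) (hK : Primrec K) (hL : Primrec L)
    (hB : Primrec B) :
    Primrec fun i => hasCounterexample (a i) (c i) (φ i) (ψ i) (K i) (L i) (B i) := by
  unfold hasCounterexample
  fun_prop

@[fun_prop] theorem primrec_numSnapshots {b : α → List ℕ} {φ ψ : α → Formula} (hb : Primrec b)
    (hφ : Primrec φ) (hψ : Primrec ψ) :
    Primrec fun i => numSnapshots (b i) (φ i) (ψ i) := by
  unfold numSnapshots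
  fun_prop

@[fun_prop] theorem primrec_waitBound {N : α → ℕ} (hN : Primrec N) :
    Primrec fun i => waitBound (N i) := by
  unfold waitBound
  fun_prop

@[fun_prop] theorem primrec_holdBound {N K : α → ℕ} (hN : Primrec N) (hK : Primrec K) :
    Primrec fun i => holdBound (N i) (K i) := by
  unfold holdBound
  fun_prop

@[fun_prop] theorem primrec_lassoBound {N W : α → ℕ} (hN : Primrec N) (hW : Primrec W) :
    Primrec fun i => lassoBound (N i) (W i) := by
  unfold lassoBound
  fun_prop

theorem primrec_solve : Primrec solve := by
  unfold solve
  fun_prop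

end Codes

/-! ### Correctness of the evaluation -/

section Truth

theorem fold_fold_add {t m : ℕ} (h : t < m) (n j : ℕ) :
    fold t m (fold t m n + j) = fold t m (n + j) := by
  induction j with
  | zero => exact fold_of_lt (fold_lt h n)
  | succ j ih => rw [← add_assoc, ← add_assoc, fold_succ h, fold_succ h, ih]

theorem Formula.sat_congr {w : ℕ → Set Atom} {k : ℕ} (φ : Formula) :
    ∀ {n n' : ℕ}, (∀ j, w (n + j) = w (n' + j)) → (φ.Sat w n k ↔ φ.Sat w n' k) := by
  have shift : ∀ {n n' : ℕ}, (∀ j, w (n + j) = w (n' + j)) →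
      ∀ i j, w (n + i + j) = w (n' + i + j) := by
    intro n n' h i j
    rw [add_assoc, add_assoc, h]
  induction φ with
  | atom a => intro n n' h; simp only [Sat]; rw [← add_zero n, h 0, add_zero]
  | natom a => intro n n' h; simp only [Sat]; rw [← add_zero n, h 0, add_zero]
  | next φ ih => intro n n' h; exact ih (shift h 1)
  | prompt φ ih =>
    intro n n' h
    simp only [Sat, ih (shift h _)]
  | conj φ ψ ih₁ ih₂ => intro n n' h; simp only [Sat, ih₁ h, ih₂ h]
  | disj φ ψ ih₁ ih₂ => intro n n' h; simp only [Sat, ih₁ h, ih₂ h]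
  | strongUntil φ ψ ih₁ ih₂ => intro n n' h; simp only [Sat, ih₁ (shift h _), ih₂ (shift h _)]
  | release φ ψ ih₁ ih₂ => intro n n' h; simp only [Sat, ih₁ (shift h _), ih₂ (shift h _)]

/-- A least witness `j ≥ m` could be lowered by the period `m - t`, since `i + j - (m - t)` is still
at least `t`. So looking `m` positions ahead suffices for until. -/
theorem exists_lt_until_iff {t m : ℕ} (h : t < m) {P R : ℕ → Prop}
    (hP : ∀ n, P (fold t m n) ↔ P n) (i : ℕ) :
    (∃ j < m, P (i + j) ∧ ∀ i' < j, R (i + i')) ↔ ∃ j, P (i + j) ∧ ∀ i' < j, R (i + i') := by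
  classical
  constructor
  · rintro ⟨j, -, hj⟩
    exact ⟨j, hj⟩
  · rintro ⟨j, hj, hR⟩
    have hex : ∃ j, P (i + j) := ⟨j, hj⟩
    refine ⟨Nat.find hex, ?_, Nat.find_spec hex, fun i' hi' =>
      hR i' (hi'.trans_le (Nat.find_min' hex hj))⟩
    by_contra! hm
    refine Nat.find_min hex (m := Nat.find hex - (m - t)) (by omega) ?_
    rw [← hP]
    have h1 := fold_add_mul h (n := i + (Nat.find hex - (m - t))) (by omega) 1
    rw [← h1, show i + (Nat.find hex - (m - t)) + 1 * (m - t) = i + Nat.find hex by omega, hP]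
    exact Nat.find_spec hex

theorem getD_truth {w : List (List Atom)} {t k : ℕ} (ht : t < w.length) {v : ℕ → Set Atom}
    (hv : ∀ n a, a ∈ v n ↔ a ∈ w.getD (fold t w.length n) []) (φ : Formula) :
    ∀ i < w.length, (truth w t k φ).getD i false = true ↔ φ.Sat v i k := by
  have hsat : ∀ (φ : Formula) n, φ.Sat v (fold t w.length n) k ↔ φ.Sat v n k := by
    intro φ n
    refine φ.sat_congr fun j => ?_
    ext a
    rw [hv, hv, fold_fold_add ht]
  have hneg : ∀ φ : Formula, ∀ n, ¬ φ.Sat v (fold t w.length n) k ↔ ¬ φ.Sat v n k :=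
    fun φ n => not_congr (hsat φ n)
  induction φ with
  | atom a =>
    intro i hi
    simp [truth, truthRow, hi, Formula.Sat, hv, fold_of_lt hi]
  | natom a =>
    intro i hi
    simp [truth, truthRow, hi, Formula.Sat, hv, fold_of_lt hi]
  | next φ ih =>
    intro i hi
    simp only [List.getD_eq_getElem?_getD] at ih
    simp [truth, truthRow, hi, Formula.Sat, ih _ (fold_lt ht _), hsat]
  | prompt φ ih =>
    intro i hi
    simp only [List.getD_eq_getElem?_getD] at ih
    simp [truth, truthRow, hi, Formula.Sat, ih _ (fold_lt ht _), hsat]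
  | conj φ ψ ih₁ ih₂ =>
    intro i hi
    simp only [List.getD_eq_getElem?_getD] at ih₁ ih₂
    simp [truth, truthRow, hi, Formula.Sat, ih₁ _ hi, ih₂ _ hi]
  | disj φ ψ ih₁ ih₂ =>
    intro i hi
    simp only [List.getD_eq_getElem?_getD] at ih₁ ih₂
    simp [truth, truthRow, hi, Formula.Sat, ih₁ _ hi, ih₂ _ hi]
  | strongUntil φ ψ ih₁ ih₂ =>
    intro i hi
    simp only [List.getD_eq_getElem?_getD] at ih₁ ih₂
    simp only [Formula.Sat]
    rw [← exists_lt_until_iff ht (P := fun n => ψ.Sat v n k) (R := fun n => φ.Sat v n k) (hsat ψ) i]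
    simp [truth, truthRow, hi, ih₁ _ (fold_lt ht _), ih₂ _ (fold_lt ht _), hsat]
  | release φ ψ ih₁ ih₂ =>
    intro i hi
    simp only [List.getD_eq_getElem?_getD] at ih₁ ih₂
    simp only [Formula.Sat]
    -- The negation of a release is an until of negations, to which the same bound applies.
    rw [← not_iff_not]
    have := exists_lt_until_iff ht (P := fun n => ¬ ψ.Sat v n k) (hneg ψ)
      (R := fun n => ¬ φ.Sat v n k) i
    simp only [not_forall, not_or, not_exists, not_and]
    rw [← this]
    simp [truth, truthRow, hi, ih₁ _ (fold_lt ht _), ih₂ _ (fold_lt ht _), hsat]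

end Truth

/-! ### Correctness of the enumeration of transition systems -/

/-- This makes the ordered lists in the codes correspond one-to-one to the sets that they describe.
-/
theorem filter_mem_eq_of_sublist {α : Type*} {l₁ l₂ : List α} (h : l₁.Sublist l₂)
    (hl : l₂.Nodup) {p : α → Prop} {_ : DecidablePred p} (hp : ∀ a, p a ↔ a ∈ l₁) :
    l₂.filter p = l₁ := by
  have h1 : l₁.Sublist (l₂.filter p) := by
    have := h.filter p
    rwa [List.filter_eq_self.2 fun a ha => decide_eq_true ((hp a).2 ha)] at this
  refine (h1.eq_of_length_le ?_).symm
  exact ((hl.filter _).subperm fun a ha =>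
    (hp a).1 (of_decide_eq_true (List.mem_filter.1 ha).2)).length_le

theorem mem_sections_map_iff {α β : Type*} {l : List α} {F : α → List β} {f : List β} :
    f ∈ (l.map F).sections ↔ ∃ h : f.length = l.length,
      ∀ (i : ℕ) (hi : i < l.length), f[i] ∈ F l[i] := by
  rw [List.mem_sections, List.forall₂_iff_get]
  simp only [List.length_map, List.get_eq_getElem, List.getElem_map]
  exact ⟨fun ⟨h, h'⟩ => ⟨h, fun i hi => h' i (by omega) hi⟩,
    fun ⟨h, h'⟩ => ⟨h, fun i _ hi => h' i hi⟩⟩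


namespace Architecture

variable (A : Architecture) (p : Fin A.numSys)

/-- The list of the inputs of a process, in the order of `implCode`. -/
def inputList : List Atom := (Sum.inr (p : ℕ) : Atom) :: ((A.inp p).sort (· ≤ ·)).map Sum.inl

theorem mem_inputList {a : Atom} : a ∈ A.inputList p ↔ a ∈ A.inpStar p := by
  simp [inputList, inpStar]

theorem nodup_inputList : (A.inputList p).Nodup := by
  rw [inputList, List.nodup_cons]
  refine ⟨by simp, (Finset.sort_nodup _ _).map Sum.inl_injective⟩

theorem nodup_inputLetters :
    (inputLetters (p : ℕ) ((A.inp p).sort (· ≤ ·))).Nodup :=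
  List.nodup_sublists.2 (A.nodup_inputList p)

/-- The state of a process never changes on an input letter without `sched_p`. -/
def IsIdle {S : Type} (T : TransitionSystem (A.inpStar p) (A.outStar p) S) : Prop :=
  ∀ s (x : Set (A.inpStar p)), (∀ a ∈ x, (a : Atom) ≠ Sum.inr (p : ℕ)) → T.step s x = s

open Classical in
/-- The description of the transition system of one process. -/
noncomputable def processCode {b : ℕ} (T : TransitionSystem (A.inpStar p) (A.outStar p) (Fin b)) :
    ℕ × List (List ℕ) × List (List ℕ) :=
  ((T.init : ℕ),
    List.ofFn fun s : Fin b => (inputLetters (p : ℕ) ((A.inp p).sort (· ≤ ·))).map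
      fun x => ((T.step s {a | (a : Atom) ∈ x} : Fin b) : ℕ),
    List.ofFn fun s : Fin b =>
      ((A.out p).sort (· ≤ ·)).filter fun o => ∃ a ∈ T.label s, (a : Atom) = Sum.inl o)

theorem implCode_eq {b : Fin A.numSys → ℕ}
    (T : ∀ p, TransitionSystem (A.inpStar p) (A.outStar p) (Fin (b p))) :
    A.implCode T = List.ofFn fun p => A.processCode p (T p) := rfl

variable {p}

theorem processCode_mem {b : ℕ} {T : TransitionSystem (A.inpStar p) (A.outStar p) (Fin b)}
    (hT : A.IsIdle p T) :
    A.processCode p T ∈ processCandidates p b ((A.inp p).sort (· ≤ ·))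
      ((A.out p).sort (· ≤ ·)) := by
  simp only [processCandidates, List.mem_flatMap, List.mem_map, List.mem_range]
  refine ⟨T.init, T.init.2, _, ?_, _, ?_, rfl⟩
  · rw [mem_sections_map_iff]
    refine ⟨by simp, fun s hs => ?_⟩
    simp only [List.getElem_ofFn, List.getElem_range]
    rw [mem_sections_map_iff]
    refine ⟨by simp, fun i hi => ?_⟩
    simp only [List.getElem_map]
    generalize (inputLetters (p : ℕ) ((A.inp p).sort (· ≤ ·)))[i] = x
    cases hx : x.elem (Sum.inr (p : ℕ) : Atom)
    · simp only [cond_false, List.mem_singleton]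
      rw [hT _ _ fun a ha hp => ?_]
      have : (Sum.inr (p : ℕ) : Atom) ∈ x := hp ▸ ha
      rw [← List.elem_iff, hx] at this
      simp at this
    · simp
  · rw [mem_sections_map_iff]
    refine ⟨by simp, fun s hs => ?_⟩
    simp

theorem exists_of_mem_processCandidates {b : ℕ} {c : ℕ × List (List ℕ) × List (List ℕ)}
    (hc : c ∈ processCandidates p b ((A.inp p).sort (· ≤ ·)) ((A.out p).sort (· ≤ ·))) :
    ∃ T : TransitionSystem (A.inpStar p) (A.outStar p) (Fin b),
      A.IsIdle p T ∧ A.processCode p T = c := by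
  classical
  simp only [processCandidates, List.mem_flatMap, List.mem_map, List.mem_range] at hc
  obtain ⟨i, hi, δ, hδ, o, ho, rfl⟩ := hc
  rw [mem_sections_map_iff] at hδ ho
  obtain ⟨hδl, hδ⟩ := hδ
  obtain ⟨hol, ho⟩ := ho
  simp only [List.length_range, List.getElem_range, mem_sections_map_iff,
    List.mem_sublists] at hδl hδ hol ho
  set letters := inputLetters (p : ℕ) ((A.inp p).sort (· ≤ ·)) with hletters
  -- The inputs in `x`, listed in the order of `inputList`; this is the letter whose column is
  -- looked up.
  let column : Set (A.inpStar p) → List Atom := fun x =>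
    (A.inputList p).filter fun a => ∃ y ∈ x, (y : Atom) = a
  have hcol : ∀ x, column x ∈ letters := fun x =>
    List.mem_sublists.2 List.filter_sublist
  have hidx : ∀ x, letters.idxOf (column x) < letters.length := fun x =>
    List.idxOf_lt_length_of_mem (hcol x)
  have hentry : ∀ (s : Fin b) (j : ℕ) (hj : j < letters.length),
      (δ[s])[j]'((hδ s s.2).1 ▸ hj) ∈
        cond (letters[j].elem (Sum.inr (p : ℕ) : Atom)) (List.range b) [(s : ℕ)] :=
    fun s j hj => (hδ s s.2).2 j hj
  have hlt : ∀ (s : Fin b) (j : ℕ) (hj : j < letters.length),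
      (δ[s])[j]'((hδ s s.2).1 ▸ hj) < b := by
    intro s j hj
    have := hentry s j hj
    cases hx : letters[j].elem (Sum.inr (p : ℕ) : Atom) <;> simp only [hx, cond_true, cond_false,
      List.mem_singleton, List.mem_range] at this
    · omega
    · exact this
  let T : TransitionSystem (A.inpStar p) (A.outStar p) (Fin b) :=
    { init := ⟨i, hi⟩
      step := fun s x => ⟨_, hlt s _ (hidx x)⟩
      label := fun s => {a | ∃ n ∈ o[s], (a : Atom) = Sum.inl n} }
  refine ⟨T, fun s x hx => ?_, ?_⟩
  · have := hentry s _ (hidx x)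
    have hx' : (column x).elem (Sum.inr (p : ℕ) : Atom) = false := by
      by_contra h
      rw [Bool.not_eq_false, List.elem_iff] at h
      obtain ⟨y, hy, hyp⟩ := of_decide_eq_true (List.mem_filter.1 h).2
      exact hx y hy hyp
    rw [List.getElem_idxOf, hx'] at this
    simp only [cond_false, List.mem_singleton] at this
    exact Fin.ext this
  · have h1 : (T.init : ℕ) = i := rfl
    simp only [processCode, h1, Prod.mk.injEq, true_and]
    constructor
    · refine List.ext_getElem (by simp [hδl]) fun s h1 h2 => ?_
      have hs : s < b := by omega
      refine List.ext_getElem (by simp [(hδ s hs).1, hletters]) fun j h3 h4 => ?_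
      have hj : j < letters.length := (hδ s hs).1 ▸ h4
      simp only [List.getElem_ofFn, List.getElem_map, T]
      have hcj : column {a | (a : Atom) ∈ letters[j]} = letters[j] := by
        have hsub : letters[j].Sublist (A.inputList p) :=
          List.mem_sublists.1 (List.getElem_mem hj)
        refine filter_mem_eq_of_sublist hsub (A.nodup_inputList p) fun a => ?_
        constructor
        · rintro ⟨y, hy, rfl⟩; exact hy
        · intro ha
          exact ⟨⟨a, (A.mem_inputList p).1 (hsub.subset ha)⟩, ha, rfl⟩
      have hidxj : letters.idxOf (column {a | (a : Atom) ∈ letters[j]}) = j := by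
        rw [hcj]
        exact (A.nodup_inputLetters p).idxOf_getElem j hj
      congr 1
    · refine List.ext_getElem (by simp [hol]) fun s h1 h2 => ?_
      have hs : s < b := by omega
      simp only [List.getElem_ofFn, T]
      have hsub := ho s hs
      refine filter_mem_eq_of_sublist hsub (Finset.sort_nodup _ _) fun a => ?_
      constructor
      · rintro ⟨y, ⟨n, hn, hy⟩, hya⟩
        rw [hy, Sum.inl.injEq] at hya
        exact hya ▸ hn
      · intro ha
        refine ⟨⟨Sum.inl a, ?_⟩, ⟨a, ha, rfl⟩, rfl⟩
        have := hsub.subset ha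
        rw [Finset.mem_sort] at this
        simp [outStar, this]

theorem code_length : A.code.2.length = A.numSys := by simp [code]

theorem code_getD (p : Fin A.numSys) :
    A.code.2.getD p ([], []) = ((A.inp p).sort (· ≤ ·), (A.out p).sort (· ≤ ·)) := by
  simp [code, List.getD_eq_getElem?_getD]

theorem mem_candidates_iff {b : Fin A.numSys → ℕ} {d : ImplCode} :
    d ∈ candidates A.code (List.ofFn b) ↔
      ∃ T : ∀ p, TransitionSystem (A.inpStar p) (A.outStar p) (Fin (b p)),
        (∀ p, A.IsIdle p (T p)) ∧ A.implCode T = d := by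
  have hb : ∀ p : Fin A.numSys, (List.ofFn b).getD p 0 = b p := fun p => by
    simp [List.getD_eq_getElem?_getD]
  rw [candidates, mem_sections_map_iff]
  simp only [List.length_range, code_length, List.getElem_range]
  constructor
  · rintro ⟨hl, h⟩
    have h' : ∀ p : Fin A.numSys, ∃ T : TransitionSystem (A.inpStar p) (A.outStar p) (Fin (b p)),
        A.IsIdle p T ∧ A.processCode p T = d[(p : ℕ)] := by
      intro p
      have := h p p.2
      rw [hb, code_getD] at this
      exact A.exists_of_mem_processCandidates this
    choose T hT hTc using h'
    refine ⟨T, hT, ?_⟩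
    rw [implCode_eq]
    refine List.ext_getElem (by simp [hl]) fun i h1 h2 => ?_
    simp [hTc]
  · rintro ⟨T, hT, rfl⟩
    rw [implCode_eq]
    refine ⟨by simp, fun i hi => ?_⟩
    have := A.processCode_mem (hT ⟨i, hi⟩)
    have h1 := hb ⟨i, hi⟩
    have h2 := A.code_getD ⟨i, hi⟩
    simp only at h1 h2
    rw [h1, h2, List.getElem_ofFn]
    exact this

end Architecture

/-! ### Correctness of the search for counterexamples -/

namespace Architecture

variable (A : Architecture) {b : Fin A.numSys → ℕ}
  (T : ∀ p, TransitionSystem (A.inpStar p) (A.outStar p) (Fin (b p)))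

theorem mem_envAtoms {a : Atom} : a ∈ envAtoms A.code ↔ a ∈ A.envOutStar := by
  simp only [envAtoms, code_length, envOutStar, List.mem_append, List.mem_map, List.mem_range,
    Finset.mem_union, Finset.mem_image, Finset.mem_univ, true_and]
  refine or_congr (by simp [code]) ?_
  constructor
  · rintro ⟨i, hi, rfl⟩; exact ⟨⟨i, hi⟩, rfl⟩
  · rintro ⟨p, rfl⟩; exact ⟨p, p.2, rfl⟩

theorem implCode_length : (A.implCode T).length = A.numSys := by simp [implCode]

theorem implCode_getD (p : Fin A.numSys) :
    (A.implCode T).getD p (0, [], []) = A.processCode p (T p) := by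
  simp [implCode_eq, List.getD_eq_getElem?_getD]

theorem ofFn_getD {n : ℕ} {α : Type*} (f : Fin n → α) (d : α) (p : Fin n) :
    (List.ofFn f).getD p d = f p := by
  simp [List.getD_eq_getElem?_getD]

theorem map_range_numSys {α : Type*} (f : ℕ → α) :
    (List.range A.numSys).map f = List.ofFn fun p : Fin A.numSys => f p := by
  refine List.ext_getElem (by simp) fun i h1 h2 => by simp

theorem mem_letterOf {s : ∀ p, Fin (b p)} {e : List Atom} {a : Atom} :
    a ∈ letterOf (A.implCode T) (List.ofFn fun p => (s p : ℕ)) e ↔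
      a ∈ e ∨ ∃ p, ∃ y ∈ (T p).label (s p), (y : Atom) = a := by
  classical
  have key : ∀ p : Fin A.numSys, a ∈ (((A.implCode T).getD p (0, [], [])).2.2.getD
      ((List.ofFn fun p => (s p : ℕ)).getD p 0) []).map Sum.inl ↔
      ∃ y ∈ (T p).label (s p), (y : Atom) = a := by
    intro p
    rw [implCode_getD, ofFn_getD, processCode, ofFn_getD]
    simp only [List.mem_map, List.mem_filter, Finset.mem_sort, decide_eq_true_eq]
    constructor
    · rintro ⟨o, ⟨-, y, hy, h⟩, rfl⟩
      exact ⟨y, hy, h⟩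
    · rintro ⟨y, hy, rfl⟩
      have := y.2
      simp only [outStar, Finset.mem_image] at this
      obtain ⟨o, ho, hoy⟩ := this
      exact ⟨o, ⟨ho, y, hy, hoy.symm⟩, hoy⟩
  rw [letterOf, implCode_length, List.mem_append]
  refine or_congr Iff.rfl ?_
  rw [List.mem_flatMap]
  constructor
  · rintro ⟨i, hi, h⟩
    exact ⟨⟨i, List.mem_range.1 hi⟩, (key ⟨i, List.mem_range.1 hi⟩).1 h⟩
  · rintro ⟨p, h⟩
    exact ⟨p, List.mem_range.2 p.2, (key p).2 h⟩

theorem nextStates_ofFn (s : ∀ p, Fin (b p)) (e : List Atom) :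
    nextStates A.code (A.implCode T) (List.ofFn fun p => (s p : ℕ)) e =
      List.ofFn fun p => ((T p).step (s p) {x | (x : Atom) ∈
        letterOf (A.implCode T) (List.ofFn fun p => (s p : ℕ)) e} : ℕ) := by
  classical
  rw [nextStates, implCode_length, map_range_numSys]
  congr 1
  funext p
  rw [implCode_getD, ofFn_getD, processCode, ofFn_getD, code_getD]
  set l := letterOf (A.implCode T) (List.ofFn fun p => (s p : ℕ)) e
  have hmem : (A.inputList p).filter (fun x => l.elem x) ∈
      inputLetters (p : ℕ) ((A.inp p).sort (· ≤ ·)) :=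
    List.mem_sublists.2 List.filter_sublist
  have hset : {x : A.inpStar p | (x : Atom) ∈ (A.inputList p).filter fun x => l.elem x} =
      {x : A.inpStar p | (x : Atom) ∈ l} := by
    ext x
    have := (A.mem_inputList p).2 x.2
    simp [this]
  rw [← hset]
  change (List.map _ _).getD (List.idxOf ((A.inputList p).filter fun x => l.elem x) _) 0 = _
  rw [List.getD_eq_getElem?_getD, List.getElem?_map,
    List.getElem?_eq_getElem (List.idxOf_lt_length_of_mem hmem), List.getElem_idxOf]
  rfl

theorem statesCode_zero (u : List (List Atom)) :
    statesCode A.code (A.implCode T) u 0 = List.ofFn fun p => ((T p).init : ℕ) := by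
  change (A.implCode T).map _ = _
  rw [implCode_eq, List.map_ofFn]
  rfl

theorem disjoint_envOutStar (p : Fin A.numSys) : Disjoint A.envOutStar (A.outStar p) := by
  rw [Finset.disjoint_left]
  intro a ha hp
  simp only [envOutStar, outStar, Finset.mem_union, Finset.mem_image] at ha hp
  obtain ⟨o, ho, rfl⟩ := hp
  rcases ha with ⟨o', ho', h⟩ | ⟨q, -, h⟩
  · rw [Sum.inl.injEq] at h
    exact Finset.disjoint_left.1 (A.disjoint_env p) ho' (h ▸ ho)
  · cases h

theorem disjoint_outStar {p q : Fin A.numSys} (hpq : p ≠ q) :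
    Disjoint (A.outStar p) (A.outStar q) := by
  rw [outStar, outStar, Finset.disjoint_image Sum.inl_injective]
  exact A.disjoint_sys p q hpq

theorem letterOf_subset_props {s : ∀ p, Fin (b p)} {e : List Atom}
    (he : ∀ a ∈ e, a ∈ envAtoms A.code) :
    {a | a ∈ letterOf (A.implCode T) (List.ofFn fun p => (s p : ℕ)) e} ⊆ (A.props : Set Atom) := by
  intro a ha
  rcases (A.mem_letterOf T).1 ha with h | ⟨p, y, -, rfl⟩
  · exact Finset.mem_union_left _ (A.mem_envAtoms.1 (he a h))
  · exact Finset.mem_union_right _ (Finset.mem_biUnion.2 ⟨p, Finset.mem_univ _, y.2⟩)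

/-- Disjointness of the outputs enters here: an output of `p` in the letter can come neither from
the environment nor from another process. -/
theorem setOf_mem_letterOf {s : ∀ p, Fin (b p)} {e : List Atom}
    (he : ∀ a ∈ e, a ∈ envAtoms A.code) (p : Fin A.numSys) :
    {y : A.outStar p | (y : Atom) ∈
      letterOf (A.implCode T) (List.ofFn fun p => (s p : ℕ)) e} = (T p).label (s p) := by
  ext y
  rw [Set.mem_ofPred_eq, mem_letterOf]
  constructor
  · rintro (h | ⟨q, z, hz, hzy⟩)
    · exact absurd y.2 (Finset.disjoint_left.1 (A.disjoint_envOutStar p)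
        (A.mem_envAtoms.1 (he _ h)))
    · by_cases hpq : p = q
      · subst hpq
        rwa [Subtype.ext hzy] at hz
      · exact absurd z.2 (Finset.disjoint_left.1 (A.disjoint_outStar hpq) (hzy ▸ y.2))
  · exact fun h => Or.inr ⟨p, y, h, rfl⟩

open Classical in
/-- The environment outputs in a letter. -/
noncomputable def envPart (x : Set Atom) : List Atom := (envAtoms A.code).filter fun a => a ∈ x

theorem mem_letterOf_envPart {w : ℕ → Set Atom}
    (hw : w ∈ A.product (fun p => (T p).strategy)) {n : ℕ} {a : Atom} :
    a ∈ letterOf (A.implCode T) (List.ofFn fun p => (A.stateAt T w n p : ℕ)) (A.envPart (w n)) ↔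
      a ∈ w n := by
  classical
  rw [mem_product_iff] at hw
  rw [mem_letterOf, envPart, List.mem_filter, decide_eq_true_iff, mem_envAtoms]
  simp only [← hw.2, Set.mem_ofPred_eq]
  constructor
  · rintro (h | ⟨p, y, hy, rfl⟩)
    · exact h.2
    · exact hy
  · intro h
    rcases Finset.mem_union.1 (hw.1 n h) with h' | h'
    · exact Or.inl ⟨h', h⟩
    · obtain ⟨p, -, hp⟩ := Finset.mem_biUnion.1 h'
      exact Or.inr ⟨p, ⟨a, hp⟩, h, rfl⟩

theorem getD_wordCode {a : ArchCode} {c : ImplCode} {u : List (List Atom)} {i : ℕ}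
    (hi : i < u.length) :
    (wordCode a c u).getD i [] = letterOf c (statesCode a c u i) (u.getD i []) := by
  simp [wordCode, List.getD_eq_getElem?_getD, hi]

theorem length_wordCode (a : ArchCode) (c : ImplCode) (u : List (List Atom)) :
    (wordCode a c u).length = u.length := by simp [wordCode]

theorem isCounterexample_iff {a : ArchCode} {c : ImplCode} {φ ψ : Formula} {K L : ℕ}
    {u : List (List Atom)} {t : ℕ} (ht : t < u.length) {v : ℕ → Set Atom}
    (hv : ∀ n x, x ∈ v n ↔ x ∈ (wordCode a c u).getD (fold t u.length n) []) :
    isCounterexample a c φ ψ K L u t = true ↔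
      statesCode a c u t = statesCode a c u u.length ∧ φ.Sat v 0 K ∧ ¬ ψ.Sat v 0 L := by
  have hlen := length_wordCode a c u
  rw [← hlen] at ht hv
  rw [isCounterexample, Bool.and_eq_true, Bool.and_eq_true, Bool.not_eq_true', beq_iff_eq,
    getD_truth ht hv φ 0 (by omega), ← Bool.not_eq_true, getD_truth ht hv ψ 0 (by omega)]

/-- The environment outputs on one stem and loop determine the word and the states. Equality of the
states at `t` and at the end is what allows the repeated outputs to produce a periodic word of the
product. -/
theorem hasCounterexample_iff (φ ψ : Formula) (K L B : ℕ) :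
    hasCounterexample A.code (A.implCode T) φ ψ K L B = true ↔
      ∃ w ∈ A.product (fun p => (T p).strategy), ∃ t, ∃ m ≤ B,
        A.IsLasso T w t m ∧ φ.Sat w 0 K ∧ ¬ ψ.Sat w 0 L := by
  simp only [hasCounterexample, List.any_eq_true, List.mem_range, mem_sections_map_iff,
    List.length_range, List.mem_sublists]
  constructor
  · rintro ⟨m, hmB, u, ⟨rfl, hu⟩, t, ht, h⟩
    have henv : ∀ n, ∀ a ∈ u.getD (fold t u.length n) [], a ∈ envAtoms A.code := by
      intro n a ha
      have hlt := fold_lt ht n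
      rw [List.getD_eq_getElem _ _ hlt] at ha
      exact (hu _ hlt).subset ha
    set v : ℕ → Set Atom := fun n =>
      {a | a ∈ (wordCode A.code (A.implCode T) u).getD (fold t u.length n) []} with hv
    obtain ⟨hst, hφ, hψ⟩ := (isCounterexample_iff ht (v := v) fun n x => Iff.rfl).1 h
    -- When the index wraps from the end to `t`, `hst` identifies the computed states.
    have hstates : ∀ n, statesCode A.code (A.implCode T) u (fold t u.length n) =
        List.ofFn fun p => (A.stateAt T v n p : ℕ) := by
      intro n
      induction n with
      | zero => rw [fold_of_lt (by omega), statesCode_zero, stateAt_zero]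
      | succ n ih =>
        have h1 : statesCode A.code (A.implCode T) u (fold t u.length (n + 1)) =
            statesCode A.code (A.implCode T) u (fold t u.length n + 1) := by
          rw [fold_succ ht]
          have := fold_lt ht n
          split_ifs
          · rfl
          · rw [hst]; congr 1; omega
        rw [h1]
        change nextStates _ _ (statesCode A.code (A.implCode T) u (fold t u.length n)) _ = _
        rw [ih, nextStates_ofFn, stateAt_succ]
        simp only [hv, Set.mem_ofPred_eq, getD_wordCode (fold_lt ht n), ih]
    have hvn : ∀ n, v n = {a | a ∈ letterOf (A.implCode T)
        (List.ofFn fun p => (A.stateAt T v n p : ℕ)) (u.getD (fold t u.length n) [])} := by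
      intro n
      rw [← hstates, ← getD_wordCode (fold_lt ht n)]
    have hff : ∀ n, fold t u.length (fold t u.length n) = fold t u.length n :=
      fun n => fold_of_lt (fold_lt ht n)
    refine ⟨v, ?_, t, u.length, by omega, ⟨ht, fun n => ⟨?_, ?_⟩⟩, hφ, hψ⟩
    · rw [mem_product_iff]
      refine ⟨fun n => ?_, fun p n => ?_⟩
      · rw [hvn]
        exact A.letterOf_subset_props T (henv n)
      · rw [hvn]
        exact A.setOf_mem_letterOf T (henv n) p
    · simp only [hv, hff]
    · have h1 := hstates (fold t u.length n)
      rw [hff, hstates n] at h1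
      have h2 := List.ofFn_injective h1
      funext p
      exact Fin.ext (congrFun h2 p).symm
  · rintro ⟨w, hw, t, m, hmB, ⟨htm, hlasso⟩, hφ, hψ⟩
    set u := (List.range m).map fun n => A.envPart (w n) with hu
    have hlen : u.length = m := by simp [hu]
    have hget : ∀ n, n < m → u.getD n [] = A.envPart (w n) := by
      intro n hn
      simp [hu, List.getD_eq_getElem?_getD, hn]
    have hstates : ∀ n, n ≤ m → statesCode A.code (A.implCode T) u n =
        List.ofFn fun p => (A.stateAt T w n p : ℕ) := by
      intro n
      induction n with
      | zero => intro _; rw [statesCode_zero, stateAt_zero]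
      | succ n ih =>
        intro hn
        change nextStates _ _ (statesCode A.code (A.implCode T) u n) _ = _
        rw [ih (by omega), nextStates_ofFn, stateAt_succ, hget n (by omega)]
        simp only [A.mem_letterOf_envPart T hw]
    refine ⟨m, by omega, u, ⟨hlen, fun i hi => ?_⟩, t, htm, ?_⟩
    · simp only [hu, List.getElem_map]
      exact List.filter_sublist
    · rw [isCounterexample_iff (hlen ▸ htm) (v := w)]
      · refine ⟨?_, hφ, hψ⟩
        rw [hlen, hstates t htm.le, hstates m le_rfl]
        have h1 := (hlasso m).2
        have h2 : fold t m m = t := by simp [fold]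
        rw [h2] at h1
        rw [h1]
      · intro n x
        have hlt := fold_lt htm n
        rw [hlen, getD_wordCode (hlen ▸ hlt), hstates _ hlt.le, hget _ hlt,
          A.mem_letterOf_envPart T hw, (hlasso n).1]

theorem numSnapshots_ofFn (b : Fin A.numSys → ℕ) (φ ψ : Formula) :
    numSnapshots (List.ofFn b) φ ψ =
      (∏ p, b p) * (2 ^ (φ.toNat + 1) * 2 ^ (ψ.toNat + 1)) := by
  rw [numSnapshots, ← List.prod_ofFn, List.prod]

/-! ### Normalization of systems, and correctness of `solve` -/

variable {A T}

theorem IsIdle.asynchronous {p : Fin A.numSys} {S : Type}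
    {T : TransitionSystem (A.inpStar p) (A.outStar p) S} (h : A.IsIdle p T) :
    A.Asynchronous p T := by
  intro u x hx
  simp only [TransitionSystem.run, List.foldl_append, List.foldl_cons, List.foldl_nil]
  exact h _ x hx

-- `Asynchronous` constrains reachable states only. Making all states idle on letters without
-- `sched_p` leaves every run unchanged, so enumerating idle systems loses no strategy.
open Classical in
theorem Asynchronous.exists_isIdle {p : Fin A.numSys} {S : Type}
    {T : TransitionSystem (A.inpStar p) (A.outStar p) S} (h : A.Asynchronous p T) :
    ∃ T' : TransitionSystem (A.inpStar p) (A.outStar p) S,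
      A.IsIdle p T' ∧ T'.strategy = T.strategy := by
  let T' : TransitionSystem (A.inpStar p) (A.outStar p) S :=
    { T with step := fun s x =>
        if ∀ a ∈ x, (a : Atom) ≠ Sum.inr (p : ℕ) then s else T.step s x }
  have hrun : ∀ u, T'.run u = T.run u := by
    intro u
    induction u using List.reverseRecOn with
    | nil => rfl
    | append_singleton u x ih =>
      have h1 : T'.run (u ++ [x]) = T'.step (T'.run u) x := by simp [TransitionSystem.run]
      rw [h1, ih]
      by_cases hx : ∀ a ∈ x, (a : Atom) ≠ Sum.inr (p : ℕ)
      · rw [h u x hx]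
        exact if_pos hx
      · have h2 : T.run (u ++ [x]) = T.step (T.run u) x := by simp [TransitionSystem.run]
        rw [h2]
        exact if_neg hx
  refine ⟨T', fun s x hx => if_pos hx, ?_⟩
  funext u
  change T.label (T'.run u) = T.label (T.run u)
  rw [hrun]

variable (A)

theorem mem_solve {b : Fin A.numSys → ℕ} {φ ψ : Formula} {c : ImplCode}
    (hc : c ∈ solve (A.code, (φ, ψ), List.ofFn b)) : A.IsSolution b φ ψ c := by
  rw [solve] at hc
  simp only [code_length, List.length_ofFn, beq_self_eq_true, cond_true] at hc
  have hc' := List.mem_of_mem_head? hc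
  rw [List.mem_filter, mem_candidates_iff] at hc'
  obtain ⟨⟨T, hT, rfl⟩, h⟩ := hc'
  refine ⟨T, fun p => (hT p).asynchronous, ?_, rfl⟩
  rw [A.satisfies_iff T φ ψ (A.numSnapshots_ofFn b φ ψ) rfl rfl, ← hasCounterexample_iff]
  simpa using h

theorem isSome_solve_iff (b : Fin A.numSys → ℕ) (φ ψ : Formula) :
    (solve (A.code, (φ, ψ), List.ofFn b)).isSome ↔ A.RealizableOfSize b φ ψ := by
  constructor
  · intro h
    obtain ⟨c, hc⟩ := Option.isSome_iff_exists.1 h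
    obtain ⟨T, hT, hs, -⟩ := A.mem_solve hc
    exact ⟨fun p => (T p).strategy, fun p => ⟨T p, hT p, rfl⟩, hs⟩
  · rintro ⟨f, hf, hs⟩
    have hf' : ∀ p, ∃ T : TransitionSystem (A.inpStar p) (A.outStar p) (Fin (b p)),
        A.IsIdle p T ∧ T.strategy = f p := by
      intro p
      obtain ⟨T, hT, hTf⟩ := hf p
      obtain ⟨T', hT', h⟩ := hT.exists_isIdle
      exact ⟨T', hT', h.trans hTf⟩
    choose T hT hTf using hf'
    obtain rfl : (fun p => (T p).strategy) = f := funext hTf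
    rw [A.satisfies_iff T φ ψ (A.numSnapshots_ofFn b φ ψ) rfl rfl, ← hasCounterexample_iff] at hs
    rw [solve]
    simp only [code_length, List.length_ofFn, beq_self_eq_true, cond_true]
    rw [List.isSome_head?, ne_eq, List.filter_eq_nil_iff]
    intro hall
    refine hall _ (A.mem_candidates_iff.2 ⟨T, hT, rfl⟩) ?_
    simpa using hs

/-- The finite state spaces are renumbered as `Fin n`, so that an unrestricted implementation is one
of some size. -/
theorem realizable_iff (φ ψ : Formula) :
    A.Realizable φ ψ ↔ ∃ b, A.RealizableOfSize b φ ψ := by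
  constructor
  · rintro ⟨f, hf, hs⟩
    choose S hS T hT hTf using hf
    choose n e using fun p => Finite.exists_equiv_fin (S p)
    refine ⟨n, f, fun p => ?_, hs⟩
    let e' := (e p).some
    let T' : TransitionSystem (A.inpStar p) (A.outStar p) (Fin (n p)) :=
      { init := e' (T p).init
        step := fun s x => e' ((T p).step (e'.symm s) x)
        label := fun s => (T p).label (e'.symm s) }
    have hrun : ∀ u, T'.run u = e' ((T p).run u) := by
      intro u
      induction u using List.reverseRecOn with
      | nil => rfl
      | append_singleton u x ih =>
        have h1 : T'.run (u ++ [x]) = T'.step (T'.run u) x := by simp [TransitionSystem.run]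
        have h2 : (T p).run (u ++ [x]) = (T p).step ((T p).run u) x := by
          simp [TransitionSystem.run]
        rw [h1, h2, ih]
        simp [T']
    refine ⟨T', fun u x hx => by rw [hrun, hrun, hT p u x hx], ?_⟩
    rw [← hTf p]
    funext u
    simp only [TransitionSystem.strategy, hrun]
    simp [T']
  · rintro ⟨b, f, hf, hs⟩
    refine ⟨f, fun p => ?_, hs⟩
    obtain ⟨T, hT⟩ := hf p
    exact ⟨Fin (b p), inferInstance, T, hT⟩

end Architecture

/-! ### Unbounded search over sizes -/

/-- Search for sizes for which there is a solution. -/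
def synthesize (x : ArchCode × (Formula × Formula)) : Part ImplCode :=
  Nat.rfindOpt fun n => solve (x.1, x.2, Denumerable.ofNat (List ℕ) n)

theorem partrec_synthesize : Partrec synthesize := by
  have hp : Primrec fun y : (ArchCode × (Formula × Formula)) × ℕ =>
      (y.1.1, y.1.2, Denumerable.ofNat (List ℕ) y.2) :=
    (Primrec.fst.comp Primrec.fst).pair
      ((Primrec.snd.comp Primrec.fst).pair ((Primrec.ofNat (List ℕ)).comp Primrec.snd))
  exact Partrec.rfindOpt (primrec_solve.comp hp).to_comp.to₂

/-- The search runs through lists of every length; `solve` rejects the wrong ones, so a success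
always comes from actual sizes. -/
theorem Architecture.exists_ofFn_eq (A : Architecture) {b : List ℕ} {s : Formula × Formula}
    {c : ImplCode} (h : c ∈ solve (A.code, s, b)) : ∃ b' : Fin A.numSys → ℕ, b = List.ofFn b' := by
  have hl : b.length = A.numSys := by
    by_contra hl
    have hl' : (b.length == A.numSys) = false := beq_false_of_ne hl
    simp [solve, Architecture.code_length, hl'] at h
  refine ⟨fun p => b[(p : ℕ)], ?_⟩
  refine List.ext_getElem (by simp [hl]) fun i h1 h2 => by simp

theorem Architecture.dom_synthesize_iff (A : Architecture) (φ ψ : Formula) :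
    (synthesize (A.code, (φ, ψ))).Dom ↔ A.Realizable φ ψ := by
  rw [synthesize, Nat.rfindOpt_dom, A.realizable_iff]
  constructor
  · rintro ⟨n, c, hc⟩
    obtain ⟨b, hb⟩ := A.exists_ofFn_eq hc
    rw [hb] at hc
    exact ⟨b, (A.isSome_solve_iff b φ ψ).1 (Option.isSome_iff_exists.2 ⟨c, hc⟩)⟩
  · rintro ⟨b, hb⟩
    obtain ⟨c, hc⟩ := Option.isSome_iff_exists.1 ((A.isSome_solve_iff b φ ψ).2 hb)
    refine ⟨Encodable.encode (List.ofFn b), c, ?_⟩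
    rw [Denumerable.ofNat_encode]
    exact hc

end PromptLTL

theorem mainTheorem2 :
    (∀ A : PromptLTL.Architecture,
      REPred fun s : PromptLTL.Formula × PromptLTL.Formula => A.Realizable s.1 s.2) ∧
    (∃ solve : PromptLTL.ArchCode × (PromptLTL.Formula × PromptLTL.Formula) × List ℕ →
        Option PromptLTL.ImplCode,
      Computable solve ∧
      ∀ (A : PromptLTL.Architecture) (φ ψ : PromptLTL.Formula) (b : Fin A.numSys → ℕ),
        ((solve (A.code, (φ, ψ), List.ofFn b)).isSome ↔ A.RealizableOfSize b φ ψ) ∧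
        ∀ c ∈ solve (A.code, (φ, ψ), List.ofFn b), A.IsSolution b φ ψ c) ∧
    (∃ synth : PromptLTL.ArchCode × (PromptLTL.Formula × PromptLTL.Formula) →.
        PromptLTL.ImplCode,
      Partrec synth ∧
      ∀ (A : PromptLTL.Architecture) (φ ψ : PromptLTL.Formula),
        ((synth (A.code, (φ, ψ))).Dom ↔ A.Realizable φ ψ) ∧
        ∀ c ∈ synth (A.code, (φ, ψ)), ∃ b : Fin A.numSys → ℕ, A.IsSolution b φ ψ c) := by
  refine ⟨fun A => ?_, ⟨PromptLTL.solve, PromptLTL.primrec_solve.to_comp, fun A φ ψ b =>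
    ⟨A.isSome_solve_iff b φ ψ, fun c hc => A.mem_solve hc⟩⟩,
    ⟨PromptLTL.synthesize, PromptLTL.partrec_synthesize, fun A φ ψ =>
      ⟨A.dom_synthesize_iff φ ψ, fun c hc => ?_⟩⟩⟩
  -- With the code of `A` fixed, the realizable pairs are the domain of a partial recursive
  -- function.
  · have h : Partrec fun s : PromptLTL.Formula × PromptLTL.Formula =>
        PromptLTL.synthesize (A.code, s) :=
      PromptLTL.partrec_synthesize.comp ((Computable.const A.code).pair Computable.id)
    exact h.dom_re.of_eq fun s => A.dom_synthesize_iff s.1 s.2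
  · obtain ⟨n, hn⟩ := Nat.rfindOpt_spec hc
    obtain ⟨b, hb⟩ := A.exists_ofFn_eq hn
    rw [hb] at hn
    exact ⟨b, A.mem_solve hn⟩
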